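/- **Setting.** An oriented graph $\Gamma$ with $L$ links and $N$ nodes is given by the seeds $1,\dots,2L$, a map assigning to each seed its node, and a partition of the seeds into $L$ ordered pairs (links) $\ell=(s(\ell),t(\ell))$ with $s(\ell)<t(\ell)$. Write $i\in n$ if the seed $i$ is at the node $n$. Let $\mathcal H_{\mathcal S}$ be the bosonic Fock space with vacuum $|0\rangle$ and two oscillators $a_i^A$, $A=0,1$, for each seed $i$, $[a_i^A,a_j^{B\dagger}]=\delta_{ij}\delta^{AB}$. Repeated indices are summed. Put $I_i=\tfrac12\delta_{AB}a_i^{A\dagger}a_i^B$ and $\vec J_i=\tfrac12\vec\sigma_{AB}a_i^{A\dagger}a_i^B$ ($\vec\sigma$ the Pauli matrices). Let $\mathcal H_\Gamma\subset\mathcal H_{\mathcal S}$ be the closed subspace of vectors annihilated by all link constraints $I_{s(\ell)}-I_{t(\ell)}$ and all node constraints $\sum_{i\in n}\vec J_i$, and let $P_\Gamma$ be the orthogonal projector onto it. For half-integers $j_\ell\in\{0,\tfrac12,1,\dots\}$, one for each link, let $\mathcal P_{\{j_\ell\}}$ be the orthogonal projector onto the subspace of $\mathcal H_\Gamma$ on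 which $I_{s(\ell)}=I_{t(\ell)}=j_\ell$ for all $\ell$. Put $j_i=j_\ell$ if the seed $i$ belongs to the link $\ell$, and $J_n=\sum_{i\in n}j_i$. Let $\gamma=(\gamma^{ij}_{AB})$ be a complex $4L\times4L$ matrix, with rows and columns indexed by the pairs $(i,A)$, such that $\gamma=\gamma^t$ and $1-\gamma\gamma^\dagger>0$. The (unnormalized) squeezed vacuum is $|\gamma\rangle=\exp\big(\tfrac12\gamma^{ij}_{AB}\,a_i^{A\dagger}a_j^{B\dagger}\big)|0\rangle$, and $|\Gamma,\gamma\rangle=P_\Gamma|\gamma\rangle$. Let $\epsilon_{AB}$ be antisymmetric with $\epsilon_{01}=1$ ($\epsilon^{AB}=\epsilon_{AB}$), let $F_{ij}^\dagger=\epsilon_{AB}a_i^{A\dagger}a_j^{B\dagger}$ if $i,j$ are at the same node and $F^\dagger_{ij}=0$ otherwise, and, for $x\in\mathbb R^{2L}$, let $F^\dagger_{ij}(x)=x_ix_jF^\dagger_{ij}$. These operators commute with each other. The generating function is $$G(\gamma,x)=\det\big(1-\gamma\,\epsilon F^\dagger(x)\big)^{-1/2},$$ where $\gamma\,\epsilon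 F^\dagger(x)$ is the $4L\times 4L$ matrix with entries $\gamma^{ij}_{AB}\,\epsilon^{BC}F^\dagger_{jk}(x)$ and the power is given by the binomial series $(1-u)^{-1/2}=\sum_k\binom{2k}{k}4^{-k}u^k$. The vector $G(\gamma,x)|0\rangle$ is understood as a formal state, that is, a not necessarily square-summable family of coefficients in the occupation number basis (each coefficient receives finitely many contributions and is a polynomial in $x$); derivatives in $x$ are taken coefficient by coefficient. **Statement.** The vector $|\gamma\rangle$ lies in $\mathcal H_{\mathcal S}$, and for every choice of spins $\{j_\ell\}$ $$\mathcal P_{\{j_\ell\}}|\Gamma,\gamma\rangle=\frac{1}{\prod_n(J_n+1)!}\;\prod_\ell\frac{1}{[(2j_\ell)!]^2}\left(\frac{\partial^2}{\partial x_{s(\ell)}\,\partial x_{t(\ell)}}\right)^{2j_\ell}G(\gamma,x)\bigg|_{x=0}|0\rangle .$$ Here $(J_n+1)!$ means the Gamma function value $\Gamma(J_n+2)$ when $J_n$ is not an integer (in that case both sides vanish). -/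

import Mathlib

open scoped ComplexOrder

noncomputable section

namespace LoopGravity

/-- An oriented graph with `L` links and `N` nodes in terms of its `2L` seeds: each seed lies at one
node, and the links are ordered pairs of seeds `(source, target)` that partition the seeds. -/
structure SeedGraph (L N : ℕ) where
  node : Fin (2 * L) → Fin N
  source : Fin L → Fin (2 * L)
  target : Fin L → Fin (2 * L)
  source_lt_target : ∀ l, source l < target l
  existsUnique_link : ∀ i, ∃! l, source l = i ∨ target l = i

/-! ### The bosonic lattice -/

/-- The oscillators `(i, A)`: two for each seed. -/
abbrev Osc (L : ℕ) : Type := Fin (2 * L) × Fin 2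

/-- Occupation numbers of all oscillators. -/
abbrev Occ (L : ℕ) : Type := Osc L → ℕ

/-- Arbitrary (not necessarily square-summable) families of coefficients with respect to the
orthonormal occupation number basis `∏ (a†)^m / √(m!) |0⟩`, with coordinatewise convergence. -/
abbrev FormalState (L : ℕ) : Type := Occ L → ℂ

/-- The bosonic Fock space: square-summable families of coefficients. -/
abbrev FockSpace (L : ℕ) : Type := lp (fun _ : Occ L => ℂ) 2

/-- The coefficients of a vector of the Fock space, as a linear map. -/
def coeffs (L : ℕ) : FockSpace L →ₗ[ℂ] FormalState L where
  toFun ψ := ψ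
  map_add' _ _ := rfl
  map_smul' _ _ := rfl

/-- Operators on formal states. Creation and annihilation operators, and the polynomials in them,
act on every formal state, since each coefficient of the image is a finite sum. -/
abbrev Op (L : ℕ) : Type := Module.End ℂ (FormalState L)

/-- The annihilation operator `a_p`: `a_p |m⟩ = √(m_p) |m - e_p⟩`. -/
def annihilate {L : ℕ} (p : Osc L) : Op L where
  toFun ψ m := (Real.sqrt (m p + 1) : ℂ) * ψ (Function.update m p (m p + 1))
  map_add' _ _ := by ext m; simp [mul_add]
  map_smul' _ _ := by ext m; simp [mul_left_comm]

/-- The creation operator `a_p†`: `a_p† |m⟩ = √(m_p + 1) |m + e_p⟩`. -/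
def create {L : ℕ} (p : Osc L) : Op L where
  toFun ψ m := (Real.sqrt (m p) : ℂ) * ψ (Function.update m p (m p - 1))
  map_add' _ _ := by ext m; simp [mul_add]
  map_smul' _ _ := by ext m; simp [mul_left_comm]

theorem continuous_annihilate {L : ℕ} (p : Osc L) :
    Continuous (annihilate p : FormalState L → FormalState L) :=
  continuous_pi fun _ => continuous_const.mul (continuous_apply _)

theorem continuous_create {L : ℕ} (p : Osc L) :
    Continuous (create p : FormalState L → FormalState L) :=
  continuous_pi fun _ => continuous_const.mul (continuous_apply _)

/-- The vacuum `|0⟩`. -/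
def vacuum (L : ℕ) : FormalState L := Pi.single 0 1

theorem create_mul_comm {L : ℕ} (p q : Osc L) : create p * create q = create q * create p := by
  rcases eq_or_ne p q with rfl | h
  · rfl
  · ext ψ m
    change (Real.sqrt (m p) : ℂ) * ((Real.sqrt (Function.update m p (m p - 1) q) : ℂ) *
        ψ (Function.update _ q (Function.update m p (m p - 1) q - 1))) =
      (Real.sqrt (m q) : ℂ) * ((Real.sqrt (Function.update m q (m q - 1) p) : ℂ) *
        ψ (Function.update _ p (Function.update m q (m q - 1) p - 1)))
    rw [Function.update_of_ne h, Function.update_of_ne h.symm, Function.update_comm h]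
    ring

/-- The antisymmetric tensor, with `ε₀₁ = 1`. -/
def eps : Matrix (Fin 2) (Fin 2) ℂ := !![0, 1; -1, 0]

/-- The Pauli matrices. -/
def pauli : Fin 3 → Matrix (Fin 2) (Fin 2) ℂ :=
  ![!![0, 1; 1, 0], !![0, -Complex.I; Complex.I, 0], !![1, 0; 0, -1]]

/-- The flux `J_i^a = ½ σ^a_{AB} a_i^A† a_i^B`. -/
def flux {L : ℕ} (i : Fin (2 * L)) (a : Fin 3) : Op L :=
  (1 / 2 : ℂ) • ∑ A, ∑ B, pauli a A B • (create (i, A) * annihilate (i, B))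

/-- The spin operator `I_i = ½ δ_{AB} a_i^A† a_i^B`. -/
def spinOp {L : ℕ} (i : Fin (2 * L)) : Op L :=
  (1 / 2 : ℂ) • ∑ A, create (i, A) * annihilate (i, A)

/-- For a family of coefficients `c` and an operator `T`, the vector `∑ₖ cₖ Tᵏ ψ`, summed
coefficient by coefficient. It is used below only for operators `T` that raise the number of
excitations, for which only finitely many `k` contribute to each coefficient. -/
def formalSeries {L : ℕ} (c : ℕ → ℂ) (T : Op L) (ψ : FormalState L) : FormalState L :=
  fun m => ∑' k, c k * (T ^ k) ψ m

/-! ### Squeezed vacua -/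

/-- The Siegel unit disk of symmetric matrices with `1 - γ γ† > 0`. -/
def siegelDisk (L : ℕ) : Set (Matrix (Osc L) (Osc L) ℂ) :=
  {γ | γ.transpose = γ ∧ (1 - γ * γ.conjTranspose).PosDef}

/-- The squeezed vacuum `exp(½ γ_{ij}^{AB} a_i^A† a_j^B†) |0⟩`, without normalization factor. -/
def squeezedVacuum {L : ℕ} (γ : Matrix (Osc L) (Osc L) ℂ) : FormalState L :=
  formalSeries (fun k => ((k.factorial : ℂ))⁻¹)
    ((1 / 2 : ℂ) • ∑ p, ∑ q, γ p q • (create p * create q)) (vacuum L)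

namespace SeedGraph

variable {L N : ℕ} (Γ : SeedGraph L N)

/-! ### Physical states and projectors -/

/-- The link constraint `C_ℓ = I_{s(ℓ)} - I_{t(ℓ)}`. -/
def linkConstraint (l : Fin L) : Op L := spinOp (Γ.source l) - spinOp (Γ.target l)

/-- The node (Gauss) constraint `G_n = ∑_{i ∈ n} J_i`. -/
def nodeConstraint (n : Fin N) (a : Fin 3) : Op L := ∑ i with Γ.node i = n, flux i a

/-- The Hilbert space of physical states: the vectors of the Fock space that satisfy all link and
node constraints. -/
def physical : Submodule ℂ (FockSpace L) :=
  (⨅ l, (Γ.linkConstraint l ∘ₗ coeffs L).ker) ⊓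
    ⨅ n, ⨅ a, (Γ.nodeConstraint n a ∘ₗ coeffs L).ker

/-- The physical states with spin `d ℓ / 2` at both ends of each link `ℓ`. -/
def physicalSpin (d : Fin L → ℕ) : Submodule ℂ (FockSpace L) :=
  Γ.physical ⊓ ⨅ l,
    (((spinOp (Γ.source l) - ((d l : ℂ) / 2) • (1 : Op L)) ∘ₗ coeffs L).ker ⊓
      ((spinOp (Γ.target l) - ((d l : ℂ) / 2) • (1 : Op L)) ∘ₗ coeffs L).ker)

theorem continuous_spinOp (i : Fin (2 * L)) : Continuous (spinOp i : Op L) := by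
  change Continuous fun ψ => spinOp i ψ
  simp only [spinOp, LinearMap.smul_apply, LinearMap.sum_apply, Module.End.mul_apply]
  have h1 (p : Osc L) := continuous_create p
  have h2 (p : Osc L) := continuous_annihilate p
  fun_prop

theorem continuous_nodeConstraint (n : Fin N) (a : Fin 3) : Continuous (Γ.nodeConstraint n a) := by
  change Continuous fun ψ => Γ.nodeConstraint n a ψ
  simp only [nodeConstraint, flux, LinearMap.smul_apply, LinearMap.sum_apply, Module.End.mul_apply]
  have h1 (p : Osc L) := continuous_create p
  have h2 (p : Osc L) := continuous_annihilate p
  fun_prop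

theorem isClosed_ker_comp_coeffs {T : Op L} (hT : Continuous T) :
    IsClosed ((T ∘ₗ coeffs L).ker : Set (FockSpace L)) :=
  isClosed_singleton.preimage (hT.comp lp.uniformContinuous_coe.continuous)

theorem isClosed_physical : IsClosed (Γ.physical : Set (FockSpace L)) := by
  simp only [physical, Submodule.coe_inf, Submodule.coe_iInf]
  exact (isClosed_iInter fun _ => isClosed_ker_comp_coeffs
      ((continuous_spinOp _).sub (continuous_spinOp _))).inter
    (isClosed_iInter fun _ => isClosed_iInter fun _ =>
      isClosed_ker_comp_coeffs (Γ.continuous_nodeConstraint _ _))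

theorem isClosed_physicalSpin (d : Fin L → ℕ) :
    IsClosed (Γ.physicalSpin d : Set (FockSpace L)) := by
  simp only [physicalSpin, Submodule.coe_inf, Submodule.coe_iInf]
  exact Γ.isClosed_physical.inter (isClosed_iInter fun _ =>
    (isClosed_ker_comp_coeffs ((continuous_spinOp _).sub (continuous_id.const_smul _))).inter
      (isClosed_ker_comp_coeffs ((continuous_spinOp _).sub (continuous_id.const_smul _))))

instance : CompleteSpace Γ.physical := Γ.isClosed_physical.completeSpace_coe

instance (d : Fin L → ℕ) : CompleteSpace (Γ.physicalSpin d) :=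
  (Γ.isClosed_physicalSpin d).completeSpace_coe

/-- The orthogonal projector `P_Γ` onto the physical states. -/
def physicalProjector : FockSpace L →L[ℂ] FockSpace L := Γ.physical.starProjection

/-- The orthogonal projector onto the physical states with spins `d ℓ / 2`. -/
def spinProjector (d : Fin L → ℕ) : FockSpace L →L[ℂ] FockSpace L :=
  (Γ.physicalSpin d).starProjection

/-! ### The generating function -/

/-- The wedge creation operator `F_{ij}† = ε_{AB} a_i^A† a_j^B†` if the seeds `i` and `j` are at the
same node, and `0` otherwise. -/
def wedge (i j : Fin (2 * L)) : Op L :=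
  if Γ.node i = Γ.node j then ∑ A, ∑ B, eps A B • (create (i, A) * create (j, B)) else 0

theorem wedge_mul_comm (i j k l : Fin (2 * L)) :
    Γ.wedge i j * Γ.wedge k l = Γ.wedge k l * Γ.wedge i j := by
  have h (p q : Osc L) : Commute (create p) (create q) := create_mul_comm p q
  suffices Commute (Γ.wedge i j) (Γ.wedge k l) from this
  unfold wedge
  split_ifs
  · exact Commute.sum_left _ _ _ fun A _ => Commute.sum_left _ _ _ fun B _ =>
      Commute.sum_right _ _ _ fun C _ => Commute.sum_right _ _ _ fun D _ =>
        Commute.smul_left (Commute.smul_right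
          (((h _ _).mul_right (h _ _)).mul_left ((h _ _).mul_right (h _ _))) _) _
  all_goals simp

/-- The set of all wedge creation operators. -/
def wedges : Set (Op L) := {T | ∃ i j, T = Γ.wedge i j}

/-- The commutative algebra of operators generated by the wedge creation operators. -/
abbrev WedgeAlgebra : Subalgebra ℂ (Op L) := Algebra.adjoin ℂ Γ.wedges

instance : CommRing Γ.WedgeAlgebra where
  mul_comm := (Algebra.isMulCommutative_adjoin ℂ (by
    rintro _ ⟨i, j, rfl⟩ _ ⟨k, l, rfl⟩
    exact Γ.wedge_mul_comm i j k l)).is_comm.comm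

/-- `F_{ij}†(x) = x_i x_j F_{ij}†`. -/
def wedgeAt (x : Fin (2 * L) → ℝ) (i j : Fin (2 * L)) : Γ.WedgeAlgebra :=
  ((x i * x j : ℝ) : ℂ) • ⟨Γ.wedge i j, Algebra.subset_adjoin ⟨i, j, rfl⟩⟩

/-- The matrix `ε F†(x)`, with entries `ε^{BC} F_{jk}†(x)`. -/
def epsWedge (x : Fin (2 * L) → ℝ) : Matrix (Osc L) (Osc L) Γ.WedgeAlgebra :=
  Matrix.of fun p q => eps p.2 q.2 • Γ.wedgeAt x p.1 q.1

/-- The operator `det(1 - γ ε F†(x))`. -/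
def detOp (γ : Matrix (Osc L) (Osc L) ℂ) (x : Fin (2 * L) → ℝ) : Γ.WedgeAlgebra :=
  (1 - γ.map (algebraMap ℂ Γ.WedgeAlgebra) * Γ.epsWedge x).det

/-- The generating function `G(γ, x) = det(1 - γ ε F†(x))^{-1/2}`, as an operator on formal states,
by the binomial series `(1 - u)^{-1/2} = ∑ₖ binom(2k, k) 4⁻ᵏ uᵏ`. -/
def generatingFunction (γ : Matrix (Osc L) (Osc L) ℂ) (x : Fin (2 * L) → ℝ)
    (ψ : FormalState L) : FormalState L :=
  formalSeries (fun k => (Nat.centralBinom k : ℂ) / 4 ^ k)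
    (1 - (Γ.detOp γ x : Op L)) ψ

/-- The partial derivative `∂/∂x_i` of a vector-valued function of `x`, coefficientwise. -/
def partialDeriv (i : Fin (2 * L)) (f : (Fin (2 * L) → ℝ) → FormalState L) :
    (Fin (2 * L) → ℝ) → FormalState L :=
  fun x m => deriv (fun t : ℝ => f (Function.update x i t) m) (x i)

/-- The differential operator `∏_ℓ (∂²/∂x_{s(ℓ)} ∂x_{t(ℓ)})^{d ℓ}`. -/
def linkDeriv (d : Fin L → ℕ) (f : (Fin (2 * L) → ℝ) → FormalState L) :
    (Fin (2 * L) → ℝ) → FormalState L :=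
  (List.finRange L).foldr
    (fun l g => (fun h => partialDeriv (Γ.source l) (partialDeriv (Γ.target l) h))^[d l] g) f

/-- The spin of a seed: the spin `d ℓ / 2` of the link `ℓ` that contains the seed. -/
def seedSpin (d : Fin L → ℕ) (i : Fin (2 * L)) : ℝ :=
  ∑ l with Γ.source l = i ∨ Γ.target l = i, (d l : ℝ) / 2

/-- The total spin `J_n = ∑_{i ∈ n} j_i` at a node. It need not be an integer. -/
def nodeSpin (d : Fin L → ℕ) (n : Fin N) : ℝ := ∑ i with Γ.node i = n, Γ.seedSpin d i

end SeedGraph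

end LoopGravity

end

noncomputable section

namespace LoopGravity

open PowerSeries (constantCoeff)
open MvPolynomial (pderiv)

/-! ### Jacobi's formula -/

/-! In the Bargmann picture a state is a function of variables `z` standing for the creation
operators, and multiplication by a variable is adjoint to its derivative. The squeezed vacuum is
exp(½ zγz); its coefficients times `m!` are the moments of a Gaussian variable `w` with covariance
`γ` (`isWick_expMoment`), so pairing it with a polynomial `f` gives the Gaussian expectation ⟨f(w)⟩.

An inverse square root of a determinant is a Gaussian expectation: ⟨exp(½ t wBw)⟩² det(1 - tγB) = 1
for symmetric `B` (`IsWick.gaussianSeries_sq_mul_det`). This is used twice. For `B = γ†` the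
coefficient of t^k is the squared norm of the part with 2k quanta, while the determinant is ∏(1 -
λ_i t) with all eigenvalues λ_i of γγ† below one; hence normalizability. For `B = εF†(z)` it turns
the generating function into ⟨exp(½ ∑ F_ij(z) F_ij(w))⟩ (`tsum_coeff_detPoly`).

The kernel ½ ∑ F_ij(z) F_ij(w) reproduces SL(2) invariants: pairing its k-th power in `z` with an
invariant Φ of weights J_n, where ∑ J_n = k, yields k! ∏(J_n+1)! Φ(w)
(`IsInvariant.pairing_moment`). This is an induction on k driven by the Capelli identity, by which ½
∑ F†_ij F_ij at a node acts on Φ as J_n(J_n+1). Hence the part of the generating function with the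
seed degrees 2j_i, divided by ∏(J_n+1)!, is invariant and has the same inner products as the
squeezed vacuum with all physical states of these spins: it is the projection. The link derivatives
at `x = 0` extract exactly this part, up to the factor ∏(2j_ℓ)!². -/

theorem _root_.Derivation.leibniz_finsetProd {R A ι : Type*} [CommSemiring R] [CommSemiring A]
    [Algebra R A] [DecidableEq ι] (D : Derivation R A A) (s : Finset ι) (f : ι → A) :
    D (∏ i ∈ s, f i) = ∑ i ∈ s, (∏ j ∈ s.erase i, f j) * D (f i) := by
  induction s using Finset.induction_on with
  | empty => simp
  | insert a s ha ih =>
    rw [Finset.prod_insert ha, D.leibniz, Finset.sum_insert ha, Finset.erase_insert ha, ih]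
    simp only [smul_eq_mul, Finset.mul_sum]
    rw [add_comm]
    congr 1
    refine Finset.sum_congr rfl fun i hi => ?_
    have hia : a ≠ i := by rintro rfl; exact ha hi
    rw [Finset.erase_insert_of_ne hia, Finset.prod_insert (by simp [ha]), mul_assoc]

/-- By Cramer's rule, the i-th diagonal entry on the right is the determinant of `M` with its i-th
column differentiated; summing over i is the product rule in each term of the permutation expansion.
-/
theorem _root_.Derivation.map_det {R A ι : Type*} [CommRing R] [CommRing A] [Algebra R A]
    [DecidableEq ι] [Fintype ι] (D : Derivation R A A) (M : Matrix ι ι A) :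
    D M.det = (M.adjugate * M.map D).trace := by
  have h1 (i : ι) : (M.adjugate * M.map D) i i =
      ∑ σ : Equiv.Perm ι, Equiv.Perm.sign σ •
        ((∏ j ∈ Finset.univ.erase i, M (σ j) j) * D (M (σ i) i)) := by
    have : (M.adjugate * M.map D) i i = (M.updateCol i fun k => D (M k i)).det := by
      rw [← Matrix.cramer_apply, Matrix.cramer_eq_adjugate_mulVec]
      simp [Matrix.mul_apply, Matrix.mulVec, dotProduct]
    rw [this, Matrix.det_apply]
    refine Finset.sum_congr rfl fun σ _ => ?_
    rw [← Finset.mul_prod_erase _ _ (Finset.mem_univ i), Matrix.updateCol_self, mul_comm]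
    congr 2
    refine Finset.prod_congr rfl fun j hj => ?_
    rw [Matrix.updateCol_ne (Finset.ne_of_mem_erase hj)]
  simp only [Matrix.trace, Matrix.diag_apply, h1]
  rw [Finset.sum_comm, Matrix.det_apply, map_sum]
  refine Finset.sum_congr rfl fun σ _ => ?_
  rw [← Finset.smul_sum, ← D.leibniz_finsetProd]
  rcases Int.units_eq_one_or (Equiv.Perm.sign σ) with h | h <;> simp [h]

/-! ### The binomial series of the inverse square root -/

/-- The power series of `(1 - X)^{-1/2}`. -/
def invSqrtSeries : PowerSeries ℂ := PowerSeries.mk fun k => (Nat.centralBinom k : ℂ) / 4 ^ k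

/-- The recursion of the central binomial coefficients is the equation 2(1 - X)g' = g, so g²(1 - X)
has zero derivative and constant term one. -/
theorem invSqrtSeries_sq_mul : invSqrtSeries ^ 2 * (1 - PowerSeries.X) = 1 := by
  have h : 2 * PowerSeries.derivative ℂ invSqrtSeries * (1 - PowerSeries.X) = invSqrtSeries := by
    ext n
    have h2 : (2 * PowerSeries.derivative ℂ invSqrtSeries : PowerSeries ℂ) =
        PowerSeries.C (2 : ℂ) * PowerSeries.derivative ℂ invSqrtSeries := by rw [map_ofNat]
    have hc (n : ℕ) : ((n : ℂ) + 1) * (Nat.centralBinom (n + 1) : ℂ) =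
        2 * (2 * n + 1) * (Nat.centralBinom n : ℂ) := by
      exact_mod_cast Nat.succ_mul_centralBinom_succ n
    rw [mul_sub, mul_one, map_sub, h2]
    have h4 (n : ℕ) : (4 : ℂ) ^ n ≠ 0 := pow_ne_zero _ (by norm_num)
    rcases n with _ | n
    · rw [PowerSeries.coeff_zero_mul_X, PowerSeries.coeff_C_mul, PowerSeries.coeff_derivative]
      have := hc 0
      simp only [invSqrtSeries, PowerSeries.coeff_mk]
      norm_num [Nat.centralBinom, Nat.choose] at this ⊢
    · rw [PowerSeries.coeff_succ_mul_X, PowerSeries.coeff_C_mul, PowerSeries.coeff_C_mul,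
        PowerSeries.coeff_derivative, PowerSeries.coeff_derivative]
      have := hc (n + 1)
      simp only [invSqrtSeries, PowerSeries.coeff_mk, pow_succ] at this ⊢
      have h5 := h4 n
      push_cast at this ⊢
      field_simp
      linear_combination 2 * this
  apply PowerSeries.derivative.ext
  · have h3 : PowerSeries.derivative ℂ (1 - PowerSeries.X : PowerSeries ℂ) = -1 := by simp
    rw [Derivation.leibniz, Derivation.leibniz_pow, h3, PowerSeries.derivative_one]
    simp only [smul_eq_mul, nsmul_eq_mul, pow_one, Nat.add_one_sub_one, Nat.cast_ofNat]
    linear_combination invSqrtSeries * h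
  · simp [invSqrtSeries]

/-- Power series with constant coefficient one have at most one inverse square root with constant
coefficient one. -/
theorem powerSeries_invSqrt_unique {A : Type*} [CommRing A] [IsDomain A] [Algebra ℂ A]
    {g h p : PowerSeries A} (hg : g ^ 2 * p = 1) (hh : h ^ 2 * p = 1)
    (hg0 : constantCoeff g = 1) (hh0 : constantCoeff h = 1) : g = h := by
  have hp : p ≠ 0 := by rintro rfl; simp at hg
  have h2 : g ^ 2 = h ^ 2 := mul_right_cancel₀ hp (hg.trans hh.symm)
  rcases sq_eq_sq_iff_eq_or_eq_neg.1 h2 with h3 | h3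
  · exact h3
  · have : (1 : A) = -1 := by simpa [hg0, hh0] using congrArg constantCoeff h3
    have h4 : algebraMap ℂ A 2 = 0 := by
      rw [map_ofNat]; linear_combination this
    have := (algebraMap ℂ A).injective (h4.trans (map_zero _).symm)
    norm_num at this

theorem invSqrtSeries_subst_sq_mul {A : Type*} [CommRing A] [Algebra ℂ A] {u : PowerSeries A}
    (hu : constantCoeff u = 0) : (invSqrtSeries.subst u) ^ 2 * (1 - u) = 1 := by
  have h := PowerSeries.HasSubst.of_constantCoeff_zero' hu
  have h1 := congrArg (PowerSeries.substAlgHom (R := ℂ) h) invSqrtSeries_sq_mul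
  rw [map_mul, map_pow, map_sub, map_one, PowerSeries.substAlgHom_X] at h1
  rwa [PowerSeries.coe_substAlgHom] at h1

/-- Without a constant term, `u ^ k` has order at least `k`, so the terms beyond `n` do not
contribute. -/
theorem coeff_invSqrtSeries_subst {A : Type*} [CommRing A] [Algebra ℂ A] {u : PowerSeries A}
    (hu : constantCoeff u = 0) (n : ℕ) : PowerSeries.coeff n (invSqrtSeries.subst u) =
      ∑ k ∈ Finset.range (n + 1),
        ((Nat.centralBinom k : ℂ) / 4 ^ k) • PowerSeries.coeff n (u ^ k) := by
  rw [PowerSeries.coeff_subst' (PowerSeries.HasSubst.of_constantCoeff_zero' hu),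
    finsum_eq_sum_of_support_subset (s := Finset.range (n + 1))]
  · simp [invSqrtSeries]
  · intro k hk
    by_contra hkn
    refine hk ?_
    have : PowerSeries.coeff n (u ^ k) = 0 := by
      apply PowerSeries.coeff_of_lt_order
      refine lt_of_lt_of_le ?_ (PowerSeries.le_order_pow_of_constantCoeff_eq_zero k hu)
      simp at hkn
      exact_mod_cast hkn
    simp [this]

theorem constantCoeff_invSqrtSeries_subst {A : Type*} [CommRing A] [Algebra ℂ A]
    {u : PowerSeries A} (hu : constantCoeff u = 0) :
    constantCoeff (invSqrtSeries.subst u : PowerSeries A) = 1 := by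
  have := coeff_invSqrtSeries_subst hu 0
  rw [← PowerSeries.coeff_zero_eq_constantCoeff_apply, this]
  simp

variable {ι : Type*}

/-! ### Gaussian moments -/

/-- The Wick recursion for the moments `e m = ⟨∏ w^m⟩` of a Gaussian with covariance `γ`. -/
structure IsWick [Fintype ι] (γ : Matrix ι ι ℂ) (e : (ι →₀ ℕ) → ℂ) : Prop where
  zero : e 0 = 1
  add_single : ∀ m p,
    e (m + Finsupp.single p 1) = ∑ q, γ p q * (m q * e (m - Finsupp.single q 1))

/-- The linear functional with moments `e`, on polynomials with coefficients in `A`. -/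
def moment (A : Type*) [CommRing A] [Algebra ℂ A] (e : (ι →₀ ℕ) → ℂ) :
    MvPolynomial ι A →ₗ[A] A :=
  (MvPolynomial.basisMonomials ι A).constr A fun m => algebraMap ℂ A (e m)

section

variable {A : Type*} [CommRing A] [Algebra ℂ A] {e : (ι →₀ ℕ) → ℂ}

theorem moment_monomial (m : ι →₀ ℕ) (a : A) :
    moment A e (MvPolynomial.monomial m a) = a * algebraMap ℂ A (e m) := by
  have h : MvPolynomial.monomial m a = a • MvPolynomial.basisMonomials ι A m := by
    simp [MvPolynomial.smul_monomial]
  rw [h, map_smul, moment, Module.Basis.constr_basis, smul_eq_mul]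

theorem moment_map (f : MvPolynomial ι ℂ) :
    moment A e (MvPolynomial.map (algebraMap ℂ A) f) = algebraMap ℂ A (moment ℂ e f) := by
  induction f using MvPolynomial.monomial_add_induction_on with
  | C a => rw [MvPolynomial.map_C, ← MvPolynomial.monomial_zero', ← MvPolynomial.monomial_zero',
      moment_monomial, moment_monomial]; simp
  | monomial_add m b f _ _ ih =>
    rw [map_add, map_add, ih, MvPolynomial.map_monomial, moment_monomial, map_add, moment_monomial]
    simp

variable [Fintype ι] {γ : Matrix ι ι ℂ}

theorem IsWick.moment_one (he : IsWick γ e) : moment A e 1 = 1 := by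
  rw [← MvPolynomial.C_1, ← MvPolynomial.monomial_zero', moment_monomial, he.zero]
  simp

/-- Gaussian integration by parts: Wick's recursion extended linearly from monomials. The truncated
exponent at `m q = 0` is harmless, as its factor `m q` vanishes. -/
theorem IsWick.moment_X_mul (he : IsWick γ e) (p : ι) (f : MvPolynomial ι A) :
    moment A e (MvPolynomial.X p * f) =
      ∑ q, algebraMap ℂ A (γ p q) * moment A e (pderiv q f) := by
  induction f using MvPolynomial.monomial_add_induction_on with
  | C a =>
    rw [mul_comm, MvPolynomial.X, ← MvPolynomial.monomial_zero', MvPolynomial.monomial_mul,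
      moment_monomial, he.add_single]
    simp
  | monomial_add m b f _ _ ih =>
    rw [mul_add, map_add, ih, mul_comm, MvPolynomial.X, MvPolynomial.monomial_mul,
      moment_monomial, he.add_single]
    simp only [map_add, MvPolynomial.pderiv_monomial, moment_monomial, mul_add,
      Finset.sum_add_distrib, map_sum, map_mul, map_natCast, mul_one, Finset.mul_sum]
    congr 1
    exact Finset.sum_congr rfl fun q _ => by ring

/-! ### The Gaussian generating function -/

/-- The quadratic form `½ ∑ B_{ab} w_a w_b`. -/
def quadForm (B : Matrix ι ι A) : MvPolynomial ι A :=
  (1 / 2 : ℂ) • ∑ a, ∑ b, MvPolynomial.C (B a b) * (MvPolynomial.X a * MvPolynomial.X b)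

theorem pderiv_quadForm [DecidableEq ι] {B : Matrix ι ι A} (hB : B.transpose = B) (r : ι) :
    pderiv r (quadForm B) = ∑ s, MvPolynomial.C (B r s) * MvPolynomial.X s := by
  have hB' (a b : ι) : B a b = B b a := congrFun (congrFun hB b) a |>.symm ▸ rfl
  have h2 (x : MvPolynomial ι A) : (1 / 2 : ℂ) • (x + x) = x := by
    rw [← two_smul ℂ x, smul_smul]; norm_num
  have h3 (x : MvPolynomial ι A) : pderiv r ((1 / 2 : ℂ) • x) = (1 / 2 : ℂ) • pderiv r x := by
    rw [← algebraMap_smul A, Derivation.map_smul, algebraMap_smul]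
  rw [quadForm, h3]
  simp only [map_sum, MvPolynomial.pderiv_mul, MvPolynomial.pderiv_X, MvPolynomial.pderiv_C,
    mul_add, zero_mul, zero_add, Finset.sum_add_distrib, Pi.single_apply]
  rw [Finset.sum_comm (s := Finset.univ) (t := Finset.univ) (f := fun a b =>
    MvPolynomial.C (B a b) * (_ * MvPolynomial.X b))]
  simp only [ite_mul, mul_ite, one_mul, mul_one, zero_mul, mul_zero, Finset.sum_ite_eq',
    Finset.mem_univ, if_true]
  have h4 : ∑ x, MvPolynomial.C (B x r) * MvPolynomial.X x =
      ∑ s, MvPolynomial.C (B r s) * MvPolynomial.X s :=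
    Finset.sum_congr rfl fun s _ => by rw [hB']
  simp only [h4, h2]

/-- The coefficients `⟨(½ w B w)^n⟩ / n!` of the Gaussian generating function. -/
def gaussianCoeff (e : (ι →₀ ℕ) → ℂ) (B : Matrix ι ι A) (n : ℕ) : A :=
  ((n.factorial : ℂ))⁻¹ • moment A e (quadForm B ^ n)

/-- The generating function `⟨exp(½ t w B w)⟩`. -/
def gaussianSeries (e : (ι →₀ ℕ) → ℂ) (B : Matrix ι ι A) : PowerSeries A :=
  PowerSeries.mk (gaussianCoeff e B)

theorem IsWick.gaussianCoeff_zero (he : IsWick γ e) (B : Matrix ι ι A) :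
    gaussianCoeff e B 0 = 1 := by
  simp [gaussianCoeff, he.moment_one]

theorem IsWick.constantCoeff_gaussianSeries (he : IsWick γ e) (B : Matrix ι ι A) :
    constantCoeff (gaussianSeries e B) = 1 := by
  rw [← PowerSeries.coeff_zero_eq_constantCoeff_apply, gaussianSeries, PowerSeries.coeff_mk,
    he.gaussianCoeff_zero]

/-- The generating functions `⟨w_a w_b exp(½ t w B w)⟩`. -/
def gaussianTwoPoint (e : (ι →₀ ℕ) → ℂ) (B : Matrix ι ι A) : Matrix ι ι (PowerSeries A) :=
  Matrix.of fun a b => PowerSeries.mk fun n => ((n.factorial : ℂ))⁻¹ •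
    moment A e (MvPolynomial.X a * (MvPolynomial.X b * quadForm B ^ n))

/-- The matrix `1 - t γ B`. -/
def oneSubMul [DecidableEq ι] (γ : Matrix ι ι ℂ) (B : Matrix ι ι A) :
    Matrix ι ι (PowerSeries A) :=
  1 - (PowerSeries.X : PowerSeries A) • (γ.map (algebraMap ℂ A) * B).map PowerSeries.C

theorem constantCoeff_det_oneSubMul [DecidableEq ι] (γ : Matrix ι ι ℂ) (B : Matrix ι ι A) :
    constantCoeff (oneSubMul γ B).det = 1 := by
  rw [RingHom.map_det, oneSubMul]
  have : (constantCoeff : PowerSeries A →+* A).mapMatrix (1 - (PowerSeries.X : PowerSeries A) •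
      (γ.map (algebraMap ℂ A) * B).map PowerSeries.C) = 1 := by
    ext a b
    by_cases h : a = b <;> simp [h, Matrix.one_apply]
  rw [this, Matrix.det_one]

/-- Integrate by parts in w_a. The derivative hits either w_b, which gives γ_ab times the series, or
the exponential, which gives tγB times the two-point function. Morally, the two-point function is
the series times (1 - tγB)⁻¹γ. -/
theorem IsWick.oneSubMul_mul_gaussianTwoPoint [DecidableEq ι] (he : IsWick γ e)
    {B : Matrix ι ι A} (hB : B.transpose = B) :
    oneSubMul γ B * gaussianTwoPoint e B =
      gaussianSeries e B • (γ.map (algebraMap ℂ A)).map PowerSeries.C := by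
  have key : gaussianTwoPoint e B =
      gaussianSeries e B • (γ.map (algebraMap ℂ A)).map PowerSeries.C +
        (PowerSeries.X : PowerSeries A) •
          ((γ.map (algebraMap ℂ A) * B).map PowerSeries.C * gaussianTwoPoint e B) := by
    ext a b n
    have h1 (n : ℕ) : moment A e (MvPolynomial.X a * (MvPolynomial.X b * quadForm B ^ n)) =
        algebraMap ℂ A (γ a b) * moment A e (quadForm B ^ n) +
        ∑ r, algebraMap ℂ A (γ a r) * ∑ s, B r s *
          (n • moment A e (MvPolynomial.X s * (MvPolynomial.X b * quadForm B ^ (n - 1)))) := by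
      rw [he.moment_X_mul]
      have (q : ι) : moment A e (pderiv q (MvPolynomial.X b * quadForm B ^ n)) =
          (if q = b then moment A e (quadForm B ^ n) else 0) + ∑ s, B q s *
          (n • moment A e (MvPolynomial.X s * (MvPolynomial.X b * quadForm B ^ (n - 1)))) := by
        rw [Derivation.leibniz, Derivation.leibniz_pow, pderiv_quadForm hB, map_add,
          MvPolynomial.pderiv_X, add_comm]
        congr 1
        · rw [Pi.single_apply]
          by_cases h : q = b
          · simp [h]
          · simp [h, Ne.symm h]
        · simp only [smul_eq_mul, nsmul_eq_mul, Finset.mul_sum, map_sum]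
          refine Finset.sum_congr rfl fun s _ => ?_
          rw [← nsmul_eq_mul, ← nsmul_eq_mul, ← map_nsmul, ← smul_eq_mul (B q s), ← map_smul]
          congr 1
          rw [MvPolynomial.smul_eq_C_mul, nsmul_eq_mul, nsmul_eq_mul]
          ring
      simp only [this, mul_add, Finset.sum_add_distrib, mul_ite, mul_zero, Finset.sum_ite_eq',
        Finset.mem_univ, if_true]
    simp only [Matrix.add_apply, Matrix.smul_apply, smul_eq_mul, map_add, Matrix.map_apply]
    rw [PowerSeries.coeff_mul_C]
    rcases n with _ | n
    · rw [PowerSeries.coeff_zero_X_mul]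
      have := h1 0
      simp only [zero_smul, mul_zero, Finset.sum_const_zero, add_zero] at this
      simp only [gaussianTwoPoint, gaussianSeries, gaussianCoeff, Matrix.of_apply,
        PowerSeries.coeff_mk, this, add_zero]
      simp [mul_comm]
    · rw [PowerSeries.coeff_succ_X_mul, Matrix.mul_apply, map_sum]
      simp only [Matrix.map_apply, PowerSeries.coeff_C_mul, Matrix.mul_apply, gaussianTwoPoint,
        gaussianSeries, gaussianCoeff, Matrix.of_apply, PowerSeries.coeff_mk, h1, smul_add,
        Nat.add_sub_cancel]
      congr 1
      · rw [mul_comm, smul_mul_assoc]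
      · simp only [Finset.sum_mul, Finset.mul_sum, Finset.smul_sum]
        rw [Finset.sum_comm]
        refine Finset.sum_congr rfl fun s _ => Finset.sum_congr rfl fun r _ => ?_
        have : ((n + 1).factorial : ℂ)⁻¹ * (n + 1 : ℕ) = (n.factorial : ℂ)⁻¹ := by
          have := Nat.cast_ne_zero (R := ℂ).2 n.factorial_ne_zero
          have h5 : ((n : ℂ) + 1) ≠ 0 := by exact_mod_cast n.succ_ne_zero
          rw [Nat.factorial_succ]
          push_cast
          field_simp
        rw [← this, ← Nat.cast_smul_eq_nsmul ℂ]
        simp only [mul_smul_comm, smul_smul, mul_assoc]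
  rw [oneSubMul, sub_mul, one_mul, Matrix.smul_mul, sub_eq_iff_eq_add]
  exact key

/-- Differentiation in t brings down ½ wBw, that is, a trace of `B` against the two-point function.
-/
theorem derivative_gaussianSeries (B : Matrix ι ι A) :
    (2 : PowerSeries A) * PowerSeries.derivative A (gaussianSeries e B) =
      (B.transpose.map PowerSeries.C * gaussianTwoPoint e B).trace := by
  ext n
  have h2 : (2 : PowerSeries A) = PowerSeries.C (2 : A) := by rw [map_ofNat]
  rw [h2, PowerSeries.coeff_C_mul, PowerSeries.coeff_derivative]
  simp only [Matrix.trace, Matrix.diag_apply, Matrix.mul_apply, map_sum, Matrix.map_apply,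
    Matrix.transpose_apply,
    PowerSeries.coeff_C_mul, gaussianTwoPoint, Matrix.of_apply, PowerSeries.coeff_mk,
    gaussianSeries, gaussianCoeff]
  have h3 : quadForm B ^ (n + 1) = (1 / 2 : ℂ) • ∑ a, ∑ b, B a b •
      (MvPolynomial.X a * (MvPolynomial.X b * quadForm B ^ n)) := by
    rw [pow_succ', quadForm, smul_mul_assoc, Finset.sum_mul]
    congr 1
    refine Finset.sum_congr rfl fun a _ => ?_
    rw [Finset.sum_mul]
    refine Finset.sum_congr rfl fun b _ => ?_
    rw [MvPolynomial.smul_eq_C_mul]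
    ring
  rw [h3, LinearMap.map_smul_of_tower]
  simp only [map_sum, map_smul, smul_eq_mul]
  have h4 : (2 : A) * (((n + 1).factorial : ℂ)⁻¹ • (1 / 2 : ℂ) • ∑ a, ∑ b, B a b *
      moment A e (MvPolynomial.X a * (MvPolynomial.X b * quadForm B ^ n))) * (n + 1) =
      (2 * ((n + 1).factorial : ℂ)⁻¹ * (1 / 2) * (n + 1)) • ∑ a, ∑ b, B a b *
        moment A e (MvPolynomial.X a * (MvPolynomial.X b * quadForm B ^ n)) := by
    simp only [Algebra.smul_def, map_mul, map_add, map_natCast, map_ofNat, map_one]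
    ring
  have h5 : (2 * ((n + 1).factorial : ℂ)⁻¹ * (1 / 2) * (n + 1)) = (n.factorial : ℂ)⁻¹ := by
    have := Nat.cast_ne_zero (R := ℂ).2 n.factorial_ne_zero
    have h5 : ((n : ℂ) + 1) ≠ 0 := by exact_mod_cast n.succ_ne_zero
    rw [Nat.factorial_succ]
    push_cast
    field_simp
  rw [← mul_assoc, h4, h5, Finset.sum_comm]
  simp only [Finset.smul_sum, mul_smul_comm]

/-- With W = 1 - tγB, the two-point equation gives 2g' det W = g tr(adj(W) γB), and Jacobi's formula
gives (det W)' = -tr(adj(W) γB). So g² det W is constant; the adjugate replaces the inverse of W. -/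
theorem IsWick.gaussianSeries_sq_mul_det [DecidableEq ι] [IsDomain A] (he : IsWick γ e)
    {B : Matrix ι ι A} (hB : B.transpose = B) :
    gaussianSeries e B ^ 2 * (oneSubMul γ B).det = 1 := by
  set g := gaussianSeries e B with hg
  set W := oneSubMul γ B with hW
  set G := γ.map (algebraMap ℂ A) with hG
  have h1 : 2 * PowerSeries.derivative A g * W.det =
      g * (W.adjugate * (G * B).map PowerSeries.C).trace := by
    rw [derivative_gaussianSeries, hB, mul_comm, ← smul_eq_mul, ← Matrix.trace_smul,
      ← Matrix.mul_smul, ← Matrix.one_mul (gaussianTwoPoint e B), ← Matrix.smul_mul,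
      ← Matrix.adjugate_mul, Matrix.mul_assoc, he.oneSubMul_mul_gaussianTwoPoint hB,
      Matrix.trace_mul_comm, Matrix.mul_assoc, Matrix.smul_mul, Matrix.mul_smul,
      Matrix.trace_smul, smul_eq_mul, ← Matrix.map_mul]
  have h2 : PowerSeries.derivative A W.det =
      - (W.adjugate * (G * B).map PowerSeries.C).trace := by
    rw [Derivation.map_det, ← Matrix.trace_neg, ← Matrix.mul_neg]
    congr 2
    ext1 a b
    simp only [hW, oneSubMul, Matrix.map_apply, Matrix.sub_apply, Matrix.smul_apply, map_sub,
      smul_eq_mul, Matrix.neg_apply, Derivation.leibniz, PowerSeries.derivative_C,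
      PowerSeries.derivative_X, Matrix.one_apply, apply_ite, PowerSeries.derivative_one, map_zero]
    simp [hG]
  have : CharZero A := charZero_of_injective_algebraMap (algebraMap ℂ A).injective
  apply PowerSeries.derivative.ext
  · rw [Derivation.leibniz, Derivation.leibniz_pow, h2, PowerSeries.derivative_one]
    simp only [smul_eq_mul, nsmul_eq_mul, pow_one, Nat.add_one_sub_one, Nat.cast_ofNat]
    linear_combination g * h1
  · have hdet : constantCoeff W.det = 1 := constantCoeff_det_oneSubMul γ B
    rw [map_mul, map_pow, he.constantCoeff_gaussianSeries, hdet, map_one, one_pow, one_mul]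

end

section

variable {ι : Type*} [Fintype ι]

/-! ### The moments of the squeezed vacuum -/

/-- The product `∏ m_p!`. -/
def mfact (m : ι →₀ ℕ) : ℕ := ∏ p, (m p).factorial

theorem mfact_pos (m : ι →₀ ℕ) : 0 < mfact m := Finset.prod_pos fun _ _ => Nat.factorial_pos _

theorem mfact_add_single (m : ι →₀ ℕ) (p : ι) :
    mfact (m + Finsupp.single p 1) = (m p + 1) * mfact m := by
  classical
  rw [mfact, mfact, ← Finset.mul_prod_erase _ _ (Finset.mem_univ p),
    ← Finset.mul_prod_erase _ (fun i => (m i).factorial) (Finset.mem_univ p), ← mul_assoc]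
  congr 1
  · simp [Nat.factorial_succ]
  · refine Finset.prod_congr rfl fun i hi => ?_
    simp [Finsupp.single_eq_of_ne (Finset.ne_of_mem_erase hi)]

theorem sub_single_add_single {ι : Type*} {m : ι →₀ ℕ} {p : ι} (h : m p ≠ 0) :
    m - Finsupp.single p 1 + Finsupp.single p 1 = m := by
  classical
  ext i
  by_cases hi : i = p
  · subst hi; simp; omega
  · simp [Finsupp.single_eq_of_ne hi]

theorem mfact_eq_mul_mfact_sub_single {m : ι →₀ ℕ} {p : ι} (h : m p ≠ 0) :
    mfact m = m p * mfact (m - Finsupp.single p 1) := by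
  have := mfact_add_single (m - Finsupp.single p 1) p
  rw [sub_single_add_single h] at this
  rw [this]
  simp only [Finsupp.coe_tsub, Pi.sub_apply, Finsupp.single_eq_same]
  congr 1
  omega

theorem isHomogeneous_quadForm {A : Type*} [CommRing A] [Algebra ℂ A] (B : Matrix ι ι A) :
    (quadForm B).IsHomogeneous 2 := by
  rw [quadForm, ← algebraMap_smul A, MvPolynomial.smul_eq_C_mul]
  refine MvPolynomial.IsHomogeneous.C_mul (MvPolynomial.IsHomogeneous.sum _ _ _ fun a _ =>
    MvPolynomial.IsHomogeneous.sum _ _ _ fun b _ => MvPolynomial.IsHomogeneous.C_mul ?_ _) _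
  exact (MvPolynomial.isHomogeneous_X _ a).mul (MvPolynomial.isHomogeneous_X _ b)

theorem isHomogeneous_quadForm_pow {A : Type*} [CommRing A] [Algebra ℂ A] (B : Matrix ι ι A)
    (k : ℕ) : (quadForm B ^ k).IsHomogeneous (2 * k) := (isHomogeneous_quadForm B).pow k

theorem coeff_quadForm_pow_eq_zero {A : Type*} [CommRing A] [Algebra ℂ A] (B : Matrix ι ι A)
    {k : ℕ} {m : ι →₀ ℕ} (h : 2 * k ≠ m.degree) : (quadForm B ^ k).coeff m = 0 :=
  (isHomogeneous_quadForm_pow B k).coeff_eq_zero (Ne.symm h)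

/-- The coefficients of `exp(½ z γ z)`. -/
def expCoeff (γ : Matrix ι ι ℂ) (m : ι →₀ ℕ) : ℂ :=
  (((m.degree / 2).factorial : ℂ))⁻¹ * (quadForm γ ^ (m.degree / 2)).coeff m

/-- The Gaussian moments with covariance `γ`. -/
def expMoment (γ : Matrix ι ι ℂ) (m : ι →₀ ℕ) : ℂ := mfact m * expCoeff γ m

theorem expCoeff_eq {γ : Matrix ι ι ℂ} {m : ι →₀ ℕ} {k : ℕ} (h : m.degree = 2 * k) :
    expCoeff γ m = ((k.factorial : ℂ))⁻¹ * (quadForm γ ^ k).coeff m := by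
  rw [expCoeff, h, Nat.mul_div_cancel_left _ two_pos]

/-- In odd degree the halved exponent rounds down, and powers of the quadratic form have only terms
of even degree. -/
theorem expCoeff_eq_zero {γ : Matrix ι ι ℂ} {m : ι →₀ ℕ} (h : ∀ k, m.degree ≠ 2 * k) :
    expCoeff γ m = 0 := by
  rw [expCoeff, coeff_quadForm_pow_eq_zero _ (Ne.symm (h _)), mul_zero]

/-- This is ∂_p exp(½ zγz) = (γz)_p exp(½ zγz), compared at the monomial `m`. -/
theorem expCoeff_add_single {γ : Matrix ι ι ℂ} (hγ : γ.transpose = γ) (m : ι →₀ ℕ) (p : ι) :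
    (m p + 1) * expCoeff γ (m + Finsupp.single p 1) =
      ∑ q, γ p q * if m q = 0 then 0 else expCoeff γ (m - Finsupp.single q 1) := by
  classical
  have hsub (q : ι) (hq : m q ≠ 0) : (m - Finsupp.single q 1).degree + 1 = m.degree := by
    conv_rhs => rw [← sub_single_add_single hq]
    simp
  -- Only odd `m` matter: otherwise both `m + e_p` and `m - e_q` have odd degree and all terms
  -- vanish.
  by_cases hm : ∃ k, m.degree = 2 * k + 1
  · obtain ⟨k, hk⟩ := hm
    rw [expCoeff_eq (k := k + 1) (by simp [hk]; ring)]
    have h1 := MvPolynomial.coeff_pderiv (i := p) (quadForm γ ^ (k + 1)) m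
    rw [Derivation.leibniz_pow, pderiv_quadForm hγ, Nat.add_sub_cancel, nsmul_eq_mul,
      ← map_natCast (MvPolynomial.C (R := ℂ) (σ := ι)), MvPolynomial.coeff_C_mul, smul_eq_mul,
      Finset.mul_sum, MvPolynomial.coeff_sum] at h1
    have h2 : ((k + 1).factorial : ℂ)⁻¹ * (k + 1 : ℕ) = (k.factorial : ℂ)⁻¹ := by
      have := Nat.cast_ne_zero (R := ℂ).2 k.factorial_ne_zero
      have h5 : ((k : ℂ) + 1) ≠ 0 := by exact_mod_cast k.succ_ne_zero
      rw [Nat.factorial_succ]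
      push_cast
      field_simp
    rw [mul_comm, mul_assoc, ← h1, ← mul_assoc, h2, Finset.mul_sum]
    refine Finset.sum_congr rfl fun q _ => ?_
    rw [mul_left_comm, MvPolynomial.coeff_C_mul, mul_left_comm, MvPolynomial.coeff_mul_X']
    congr 1
    by_cases hq : m q = 0
    · simp [hq]
    · have := hsub q hq
      rw [if_pos (by simpa using hq), if_neg hq, expCoeff_eq (k := k) (by omega)]
  · push Not at hm
    rw [expCoeff_eq_zero (fun k hk => ?_), mul_zero]
    · refine (Finset.sum_eq_zero fun q _ => ?_).symm
      split_ifs with hq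
      · simp
      · have := hsub q hq
        rw [expCoeff_eq_zero (fun k hk => hm k (by omega)), mul_zero]
    · simp only [map_add, Finsupp.degree_single] at hk
      exact hm (k - 1) (by omega)

theorem isWick_expMoment {γ : Matrix ι ι ℂ} (hγ : γ.transpose = γ) : IsWick γ (expMoment γ) where
  zero := by simp [expMoment, mfact, expCoeff]
  add_single m p := by
    rw [expMoment, mfact_add_single]
    push_cast
    rw [mul_comm ((m p : ℂ) + 1), mul_assoc, expCoeff_add_single hγ, Finset.mul_sum]
    refine Finset.sum_congr rfl fun q _ => ?_
    by_cases hq : m q = 0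
    · simp [hq]
    · rw [if_neg hq, expMoment, mfact_eq_mul_mfact_sub_single hq]
      push_cast
      ring

theorem moment_eq_sum {ι A : Type*} [CommRing A] [Algebra ℂ A] (e : (ι →₀ ℕ) → ℂ)
    (f : MvPolynomial ι A) :
    moment A e f = ∑ m ∈ f.support, f.coeff m * algebraMap ℂ A (e m) := by
  conv_lhs => rw [f.as_sum]
  rw [map_sum]
  exact Finset.sum_congr rfl fun m _ => moment_monomial _ _

end

/-! ### Polynomials as formal states -/

section

variable {L : ℕ}

/-- Occupation numbers as exponents. -/
abbrev expo (m : Occ L) : Osc L →₀ ℕ := Finsupp.equivFunOnFinite.symm m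

/-- The state `f(a†)|0⟩`. -/
def toState : MvPolynomial (Osc L) ℂ →ₗ[ℂ] FormalState L where
  toFun f m := (Real.sqrt (mfact (expo m)) : ℂ) * f.coeff (expo m)
  map_add' _ _ := by ext m; simp [mul_add]
  map_smul' _ _ := by ext m; simp [mul_left_comm]

theorem toState_apply (f : MvPolynomial (Osc L) ℂ) (m : Occ L) :
    toState f m = (Real.sqrt (mfact (expo m)) : ℂ) * f.coeff (expo m) := rfl

theorem sqrt_mfact_ne_zero {ι : Type*} [Fintype ι] (m : ι →₀ ℕ) :
    (Real.sqrt (mfact m) : ℂ) ≠ 0 := by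
  have := mfact_pos m
  rw [Complex.ofReal_ne_zero, Real.sqrt_ne_zero']
  exact_mod_cast this

theorem toState_injective : Function.Injective (toState (L := L)) := by
  intro f g h
  ext m
  have := congrFun h m
  rw [toState_apply, toState_apply] at this
  have h2 : expo (m : Occ L) = m := Finsupp.equivFunOnFinite_symm_coe m
  rw [h2] at this
  exact mul_left_cancel₀ (sqrt_mfact_ne_zero m) this

theorem expo_update_succ (m : Occ L) (p : Osc L) :
    expo (Function.update m p (m p + 1)) = expo m + Finsupp.single p 1 := by
  ext i
  by_cases hi : i = p
  · subst hi; simp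
  · simp [hi, Finsupp.single_eq_of_ne hi]

theorem expo_update_pred (m : Occ L) (p : Osc L) :
    expo (Function.update m p (m p - 1)) = expo m - Finsupp.single p 1 := by
  ext i
  by_cases hi : i = p
  · subst hi; simp
  · simp [hi, Finsupp.single_eq_of_ne hi]

/-- The factor √(m!) in `toState` absorbs the square roots of the ladder operators, which become
multiplication here and differentiation in `annihilate_toState`. -/
theorem create_toState (p : Osc L) (f : MvPolynomial (Osc L) ℂ) :
    create p (toState f) = toState (MvPolynomial.X p * f) := by
  ext m
  change (Real.sqrt (m p) : ℂ) * toState f (Function.update m p (m p - 1)) = _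
  rw [toState_apply, toState_apply, expo_update_pred, MvPolynomial.coeff_X_mul']
  by_cases hp : m p = 0
  · simp [hp]
  · have h : expo m p ≠ 0 := hp
    rw [if_pos (by simpa using hp), mfact_eq_mul_mfact_sub_single h, Nat.cast_mul,
      Real.sqrt_mul (Nat.cast_nonneg _)]
    simp [mul_assoc]

theorem annihilate_toState (p : Osc L) (f : MvPolynomial (Osc L) ℂ) :
    annihilate p (toState f) = toState (pderiv p f) := by
  ext m
  change (Real.sqrt (m p + 1) : ℂ) * toState f (Function.update m p (m p + 1)) = _
  rw [toState_apply, toState_apply, expo_update_succ, MvPolynomial.coeff_pderiv, mfact_add_single]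
  have h1 : (expo m) p = m p := rfl
  have h2 : ((m p : ℂ) + 1) = (Real.sqrt (m p + 1) : ℂ) * (Real.sqrt (m p + 1) : ℂ) := by
    rw [← Complex.ofReal_mul, Real.mul_self_sqrt (by positivity)]
    simp
  rw [Nat.cast_mul, Real.sqrt_mul (Nat.cast_nonneg _), h1, h2]
  push_cast
  ring

theorem toState_one : toState 1 = vacuum L := by
  ext m
  rw [toState_apply, MvPolynomial.coeff_one, vacuum]
  by_cases hm : m = 0
  · subst hm
    have h0 : expo (0 : Occ L) = 0 := by ext; rfl
    simp [h0, mfact]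
  · have h0 : (0 : Osc L →₀ ℕ) ≠ expo m := by
      intro h
      exact hm (funext fun i => (DFunLike.congr_fun h i).symm)
    simp [h0, hm]

theorem pow_toState {T : Op L} {f : MvPolynomial (Osc L) ℂ}
    (h : ∀ g, T (toState g) = toState (f * g)) (k : ℕ) :
    (T ^ k) (vacuum L) = toState (f ^ k) := by
  rw [← toState_one]
  induction k with
  | zero => simp
  | succ k ih => rw [pow_succ', Module.End.mul_apply, ih, h, pow_succ']

/-- By homogeneity, only the power with half the degree of `m` reaches the coefficient at `m`. -/
theorem squeezedVacuum_apply (γ : Matrix (Osc L) (Osc L) ℂ) (m : Occ L) :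
    squeezedVacuum γ m = (Real.sqrt (mfact (expo m)) : ℂ) * expCoeff γ (expo m) := by
  have h : ∀ g, ((1 / 2 : ℂ) • ∑ p, ∑ q, γ p q • (create p * create q)) (toState g) =
      toState (quadForm γ * g) := by
    intro g
    simp only [quadForm, LinearMap.smul_apply, LinearMap.sum_apply, Module.End.mul_apply,
      create_toState, smul_mul_assoc, map_smul, Finset.sum_mul, map_sum]
    refine congrArg _ (Finset.sum_congr rfl fun p _ => Finset.sum_congr rfl fun q _ => ?_)
    rw [← map_smul, MvPolynomial.smul_eq_C_mul]
    simp only [mul_assoc]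
  rw [squeezedVacuum, formalSeries, tsum_eq_single ((expo m).degree / 2)]
  · rw [pow_toState h, toState_apply, expCoeff]
    ring
  · intro k hk
    rw [pow_toState h, toState_apply, coeff_quadForm_pow_eq_zero, mul_zero, mul_zero]
    omega

end

section

variable {ι : Type*} [Fintype ι] [DecidableEq ι]

/-! ### The squeezed vacuum is normalizable -/

/-- Diagonalize γγ† by a unitary matrix; its constant entries drop out of the determinant over power
series. -/
theorem det_oneSubMul_conjTranspose (γ : Matrix ι ι ℂ) :
    (oneSubMul γ γ.conjTranspose).det = ∏ i, (1 - PowerSeries.C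
      (((Matrix.posSemidef_self_mul_conjTranspose γ).1.eigenvalues i : ℝ) : ℂ) *
        PowerSeries.X) := by
  set hA := (Matrix.posSemidef_self_mul_conjTranspose γ).1
  set U : Matrix ι ι ℂ := hA.eigenvectorUnitary.1
  set D : Matrix ι ι ℂ := Matrix.diagonal (RCLike.ofReal ∘ hA.eigenvalues)
  have hU : U * star U = 1 := Unitary.mul_star_self_of_mem hA.eigenvectorUnitary.2
  have hspec : γ * γ.conjTranspose = U * D * star U := by
    rw [← Unitary.conjStarAlgAut_apply (S := ℂ)]
    exact hA.spectral_theorem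
  set c : Matrix ι ι ℂ →+* Matrix ι ι (PowerSeries ℂ) := (PowerSeries.C (R := ℂ)).mapMatrix
  have h1 : oneSubMul γ γ.conjTranspose =
      c U * (1 - (PowerSeries.X : PowerSeries ℂ) • c D) * c (star U) := by
    have : oneSubMul γ γ.conjTranspose =
        1 - (PowerSeries.X : PowerSeries ℂ) • c (γ * γ.conjTranspose) := by
      rw [oneSubMul]
      congr 3
    have hUc : c U * c (star U) = 1 := by rw [← map_mul, hU, map_one]
    rw [this, hspec, map_mul, map_mul, mul_sub, sub_mul, mul_one, hUc, Matrix.mul_smul,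
      Matrix.smul_mul]
  have h2 : (c U).det * (c (star U)).det = 1 := by
    rw [← Matrix.det_mul, ← map_mul, hU, map_one, Matrix.det_one]
  rw [h1, Matrix.det_mul, Matrix.det_mul, mul_right_comm, h2, one_mul]
  have h3 : (1 - (PowerSeries.X : PowerSeries ℂ) • c D) = Matrix.diagonal fun i =>
      (1 - PowerSeries.C ((hA.eigenvalues i : ℝ) : ℂ) * PowerSeries.X) := by
    ext1 i j
    by_cases hij : i = j
    · subst hij
      simp [c, D, mul_comm]
    · simp [c, D, hij]
  rw [h3, Matrix.det_diagonal]

/-- On an eigenvector v the positive form takes the value (1 - λ)‖v‖². -/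
theorem eigenvalues_self_mul_conjTranspose_lt_one {γ : Matrix ι ι ℂ}
    (h : (1 - γ * γ.conjTranspose).PosDef) (i : ι) :
    (Matrix.posSemidef_self_mul_conjTranspose γ).1.eigenvalues i < 1 := by
  set hA := (Matrix.posSemidef_self_mul_conjTranspose γ).1
  set v : ι → ℂ := (hA.eigenvectorBasis i).ofLp with hv
  have hv0 : v ≠ 0 := by
    intro h0
    have := hA.eigenvectorBasis.orthonormal.ne_zero i
    exact this (by ext j; exact congrFun h0 j)
  have h1 := h.dotProduct_mulVec_pos hv0
  have h2 := hA.mulVec_eigenvectorBasis i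
  rw [Matrix.sub_mulVec, Matrix.one_mulVec, hv, h2, ← hv, dotProduct_sub, dotProduct_smul] at h1
  have h3 : 0 < dotProduct (star v) v := Matrix.dotProduct_star_self_pos_iff.2 hv0
  rw [Complex.real_smul, ← one_sub_mul] at h1
  rw [Complex.pos_iff] at h1 h3
  have h4 := h1.1
  rw [Complex.mul_re, ← h3.2, mul_zero, sub_zero] at h4
  have h5 := pos_of_mul_pos_left h4 h3.1.le
  simpa using h5

theorem norm_centralBinom_div_le (n : ℕ) : ‖(Nat.centralBinom n : ℂ) / 4 ^ n‖ ≤ 1 := by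
  rw [norm_div, norm_pow, Complex.norm_natCast, Complex.norm_ofNat, div_le_one (by positivity)]
  exact_mod_cast Nat.centralBinom_le_four_pow n

theorem summable_coeff_prod {κ : Type*} (s : Finset κ) (f : κ → PowerSeries ℂ)
    (hf : ∀ i ∈ s, Summable fun n => ‖PowerSeries.coeff n (f i)‖) :
    Summable fun n => ‖PowerSeries.coeff n (∏ i ∈ s, f i)‖ := by
  classical
  induction s using Finset.induction_on with
  | empty =>
    refine summable_of_ne_finset_zero (s := {0}) fun n hn => ?_
    simp [PowerSeries.coeff_one, show n ≠ 0 by simpa using hn]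
  | insert a s ha ih =>
    rw [Finset.prod_insert ha]
    simp only [PowerSeries.coeff_mul]
    exact summable_norm_sum_mul_antidiagonal_of_summable_norm
      (f := fun n => PowerSeries.coeff n (f a)) (g := fun n => PowerSeries.coeff n (∏ i ∈ s, f i))
      (hf a (Finset.mem_insert_self a s)) (ih fun i hi => hf i (Finset.mem_insert_of_mem hi))

/-- By uniqueness of the inverse square root the series is ∏(1 - λ_i t)^{-1/2}. Each factor has
coefficients bounded by λ_i^n with λ_i < 1, so the Cauchy product is absolutely summable at t = 1.
-/
theorem summable_gaussianCoeff {γ : Matrix ι ι ℂ} {e : (ι →₀ ℕ) → ℂ} (he : IsWick γ e)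
    (hγ : γ.transpose = γ) (h : (1 - γ * γ.conjTranspose).PosDef) :
    Summable fun k => ‖gaussianCoeff e γ.conjTranspose k‖ := by
  set lam := (Matrix.posSemidef_self_mul_conjTranspose γ).1.eigenvalues with hlam
  set p : PowerSeries ℂ := ∏ i, PowerSeries.rescale (lam i : ℂ) invSqrtSeries with hp
  have hB : γ.conjTranspose.transpose = γ.conjTranspose := by
    rw [Matrix.conjTranspose_transpose, Matrix.conjTranspose, hγ]
  have h1 : gaussianSeries e γ.conjTranspose = p := by
    refine powerSeries_invSqrt_unique (he.gaussianSeries_sq_mul_det hB) ?_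
      (he.constantCoeff_gaussianSeries _) ?_
    · rw [det_oneSubMul_conjTranspose, hp, ← Finset.prod_pow, ← Finset.prod_mul_distrib]
      refine Finset.prod_eq_one fun i _ => ?_
      have := congrArg (PowerSeries.rescale (lam i : ℂ)) invSqrtSeries_sq_mul
      rwa [map_mul, map_pow, map_sub, map_one, PowerSeries.rescale_X] at this
    · rw [hp, map_prod]
      refine Finset.prod_eq_one fun i _ => ?_
      rw [← PowerSeries.coeff_zero_eq_constantCoeff_apply, PowerSeries.coeff_rescale]
      simp [invSqrtSeries]
  have h2 : Summable fun k => ‖PowerSeries.coeff k p‖ := by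
    refine summable_coeff_prod _ _ fun i _ => ?_
    have h0 : 0 ≤ lam i := (Matrix.posSemidef_self_mul_conjTranspose γ).eigenvalues_nonneg i
    refine Summable.of_nonneg_of_le (fun _ => norm_nonneg _) (fun n => ?_)
      (summable_geometric_of_lt_one h0 (eigenvalues_self_mul_conjTranspose_lt_one h i))
    rw [PowerSeries.coeff_rescale, norm_mul, norm_pow, Complex.norm_real, Real.norm_of_nonneg h0,
      invSqrtSeries, PowerSeries.coeff_mk]
    exact mul_le_of_le_one_right (pow_nonneg h0 n) (norm_centralBinom_div_le n)
  refine h2.congr fun k => ?_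
  rw [← h1, gaussianSeries, PowerSeries.coeff_mk]

theorem quadForm_conjTranspose {ι : Type*} [Fintype ι] {γ : Matrix ι ι ℂ} (hγ : γ.transpose = γ) :
    quadForm γ.conjTranspose = MvPolynomial.map (starRingEnd ℂ) (quadForm γ) := by
  have hγ' (a b : ι) : γ b a = γ a b := congrFun (congrFun hγ a) b
  simp only [quadForm, MvPolynomial.smul_eq_C_mul, map_mul, map_sum, MvPolynomial.map_C,
    MvPolynomial.map_X, Matrix.conjTranspose_apply, hγ', map_div₀, map_one, map_ofNat]
  rfl

/-- For `B = γ†` the quadratic form is the conjugate of that of `γ`, so the moment pairs the part of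
exp(½ zγz) of degree 2k with its own conjugate. -/
theorem gaussianCoeff_conjTranspose {ι : Type*} [Fintype ι] {γ : Matrix ι ι ℂ} (hγ : γ.transpose = γ) (k : ℕ)
    {T : Finset (ι →₀ ℕ)} (hT : ∀ m, m ∈ T ↔ m.degree / 2 = k) :
    gaussianCoeff (expMoment γ) γ.conjTranspose k =
      ((∑ m ∈ T, mfact m * ‖expCoeff γ m‖ ^ 2 : ℝ) : ℂ) := by
  rw [gaussianCoeff, moment_eq_sum, quadForm_conjTranspose hγ, ← map_pow,
    Finset.sum_subset (s₂ := T), Finset.smul_sum, Complex.ofReal_sum]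
  · refine Finset.sum_congr rfl fun m hm => ?_
    rw [hT] at hm
    rw [Complex.ofReal_mul, Complex.ofReal_pow, ← Complex.conj_mul', expMoment, expCoeff, hm,
      MvPolynomial.coeff_map]
    simp
    ring
  · intro m hm
    rw [hT]
    by_contra h
    rw [MvPolynomial.mem_support_iff, MvPolynomial.coeff_map,
      coeff_quadForm_pow_eq_zero _ (by omega)] at hm
    simp at hm
  · intro m _ hm
    rw [MvPolynomial.notMem_support_iff.1 hm, zero_mul]

theorem summable_norm_expCoeff_sq {γ : Matrix ι ι ℂ} (hγ : γ.transpose = γ)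
    (h : (1 - γ * γ.conjTranspose).PosDef) :
    Summable fun m : ι →₀ ℕ => (mfact m : ℝ) * ‖expCoeff γ m‖ ^ 2 := by
  have hs := summable_gaussianCoeff (isWick_expMoment hγ) hγ h
  set y := fun k => ‖gaussianCoeff (expMoment γ) γ.conjTranspose k‖ with hy
  have hpos (m : ι →₀ ℕ) : 0 ≤ (mfact m : ℝ) * ‖expCoeff γ m‖ ^ 2 := by positivity
  -- Degree 2k + 1 is included so that the sets `T k` are exactly the fibres of `m.degree / 2`; its
  -- terms are zero.
  let T (k : ℕ) : Finset (ι →₀ ℕ) :=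
    Finset.univ.finsuppAntidiag (2 * k) ∪ Finset.univ.finsuppAntidiag (2 * k + 1)
  have hT (k : ℕ) (m : ι →₀ ℕ) : m ∈ T k ↔ m.degree / 2 = k := by
    have : Finset.univ.sum m = m.degree := (Finsupp.degree_eq_sum m).symm
    simp only [T, Finset.mem_union, Finset.mem_finsuppAntidiag, Finset.subset_univ, and_true, this]
    omega
  refine summable_of_sum_le (c := ∑' k, y k) hpos fun s => ?_
  rw [← Finset.sum_fiberwise_of_maps_to (t := s.image fun m => m.degree / 2)
    fun m hm => Finset.mem_image_of_mem _ hm]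
  refine le_trans (Finset.sum_le_sum fun k _ => ?_)
    (hs.sum_le_tsum _ fun k _ => norm_nonneg _)
  simp only [hy]
  rw [gaussianCoeff_conjTranspose hγ k (hT k), Complex.norm_real,
    Real.norm_of_nonneg (Finset.sum_nonneg fun m _ => hpos m)]
  refine Finset.sum_le_sum_of_subset_of_nonneg (fun m hm => ?_) fun m _ _ => hpos m
  rw [hT]
  exact (Finset.mem_filter.1 hm).2

end

theorem memℓp_squeezedVacuum {L : ℕ} {γ : Matrix (Osc L) (Osc L) ℂ} (hγ : γ ∈ siegelDisk L) :
    Memℓp (squeezedVacuum γ) 2 := by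
  rw [memℓp_gen_iff (by simp)]
  have h := (Finsupp.equivFunOnFinite (α := Osc L) (M := ℕ)).symm.summable_iff.2
    (summable_norm_expCoeff_sq hγ.1 hγ.2)
  refine h.congr fun m => ?_
  have h2 : ((2 : ENNReal).toReal) = (2 : ℕ) := by simp
  rw [h2, Real.rpow_natCast, squeezedVacuum_apply, norm_mul, mul_pow, Complex.norm_real,
    Real.norm_of_nonneg (Real.sqrt_nonneg _), Real.sq_sqrt (Nat.cast_nonneg _)]
  rfl

/-! ### Grading and scaling of polynomials -/

section

variable {ι : Type*}

/-- The homomorphism `X_p ↦ X_p t`, which separates homogeneous components. -/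
def gradeHom : MvPolynomial ι ℂ →ₐ[ℂ] Polynomial (MvPolynomial ι ℂ) :=
  MvPolynomial.aeval fun p => Polynomial.C (MvPolynomial.X p) * Polynomial.X

theorem gradeHom_monomial (m : ι →₀ ℕ) (c : ℂ) :
    gradeHom (MvPolynomial.monomial m c) =
      Polynomial.C (MvPolynomial.monomial m c) * Polynomial.X ^ m.degree := by
  rw [gradeHom, MvPolynomial.aeval_monomial, MvPolynomial.monomial_eq, Finsupp.prod, Finsupp.prod]
  simp only [mul_pow, Finset.prod_mul_distrib, Finset.prod_pow_eq_pow_sum, map_mul, map_prod,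
    map_pow, ← mul_assoc]
  rfl

theorem coeff_coeff_gradeHom (f : MvPolynomial ι ℂ) (m : ι →₀ ℕ) :
    ((gradeHom f).coeff m.degree).coeff m = f.coeff m := by
  classical
  induction f using MvPolynomial.induction_on' with
  | monomial k c =>
    rw [gradeHom_monomial, Polynomial.coeff_C_mul_X_pow]
    by_cases h : m = k
    · simp [h]
    · split_ifs <;> simp [MvPolynomial.coeff_monomial, Ne.symm h]
  | add f g hf hg => rw [map_add, Polynomial.coeff_add, MvPolynomial.coeff_add, hf, hg,
      MvPolynomial.coeff_add]

end

section

variable {L : ℕ}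

/-- The seed degree of a monomial. -/
def seedDegree (m : Osc L →₀ ℕ) (i : Fin (2 * L)) : ℕ := m (i, 0) + m (i, 1)

/-- The substitution `X_{iA} ↦ x_i X_{iA}`. -/
def scaleHom (x : Fin (2 * L) → ℝ) : MvPolynomial (Osc L) ℂ →ₐ[ℂ] MvPolynomial (Osc L) ℂ :=
  MvPolynomial.aeval fun p => MvPolynomial.C (x p.1 : ℂ) * MvPolynomial.X p

theorem coeff_scaleHom (x : Fin (2 * L) → ℝ) (f : MvPolynomial (Osc L) ℂ) (m : Osc L →₀ ℕ) :
    (scaleHom x f).coeff m = (∏ i, (x i : ℂ) ^ seedDegree m i) * f.coeff m := by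
  classical
  induction f using MvPolynomial.induction_on' with
  | monomial k c =>
    have : scaleHom x (MvPolynomial.monomial k c) =
        MvPolynomial.C (∏ i, (x i : ℂ) ^ seedDegree k i) * MvPolynomial.monomial k c := by
      rw [scaleHom, MvPolynomial.aeval_monomial, MvPolynomial.monomial_eq,
        Finsupp.prod_fintype _ _ (by simp), Finsupp.prod_fintype _ _ (by simp)]
      simp only [mul_pow, Finset.prod_mul_distrib]
      have h2 : ∏ p : Osc L, (MvPolynomial.C (x p.1 : ℂ) : MvPolynomial (Osc L) ℂ) ^ k p =
          MvPolynomial.C (∏ i, (x i : ℂ) ^ seedDegree k i) := by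
        rw [map_prod, Fintype.prod_prod_type]
        simp [seedDegree, pow_add]
      rw [h2, MvPolynomial.algebraMap_eq]
      ring
    rw [this, MvPolynomial.coeff_C_mul, MvPolynomial.coeff_monomial]
    split_ifs with h
    · rw [h]
    · simp
  | add f g hf hg => rw [map_add, MvPolynomial.coeff_add, MvPolynomial.coeff_add, hf, hg, mul_add]

end

namespace SeedGraph

variable {L N : ℕ} (Γ : SeedGraph L N)

/-! ### The wedge operators as polynomials -/

/-- The polynomial of the wedge creation operator `F_{ij}†`. -/
def bracket (i j : Fin (2 * L)) : MvPolynomial (Osc L) ℂ :=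
  if Γ.node i = Γ.node j then
    MvPolynomial.X (i, 0) * MvPolynomial.X (j, 1) - MvPolynomial.X (i, 1) * MvPolynomial.X (j, 0)
  else 0

/-- The matrix `ε F†`, with polynomial entries. -/
def bracketMatrix : Matrix (Osc L) (Osc L) (MvPolynomial (Osc L) ℂ) :=
  Matrix.of fun p q => eps p.2 q.2 • Γ.bracket p.1 q.1

/-- A product of two antisymmetric factors, ε in the spinor indices and the bracket in the seeds. -/
theorem bracketMatrix_transpose : Γ.bracketMatrix.transpose = Γ.bracketMatrix := by
  ext1 ⟨i, A⟩ ⟨j, B⟩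
  have h : Γ.bracket j i = - Γ.bracket i j := by
    simp only [bracket, eq_comm (a := Γ.node j)]
    split_ifs
    · ring
    · simp
  have he : eps B A = - eps A B := by fin_cases A <;> fin_cases B <;> simp [eps]
  simp [bracketMatrix, h, he]

theorem wedge_toState (i j : Fin (2 * L)) (g : MvPolynomial (Osc L) ℂ) :
    Γ.wedge i j (toState g) = toState (Γ.bracket i j * g) := by
  rw [wedge, bracket]
  split_ifs
  · simp only [Fin.sum_univ_two, eps, LinearMap.add_apply, LinearMap.smul_apply,
      Module.End.mul_apply, create_toState, ← map_smul, ← map_add]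
    congr 1
    simp
    ring
  · simp

/-- The pairs of an operator of the wedge algebra and the polynomial by which it acts. -/
def symbolRel : Subalgebra ℂ (Γ.WedgeAlgebra × MvPolynomial (Osc L) ℂ) where
  carrier := {z | ∀ g, (z.1 : Op L) (toState g) = toState (z.2 * g)}
  mul_mem' := by
    intro z w hz hw g
    change (z.1 : Op L) ((w.1 : Op L) (toState g)) = _
    rw [hw, hz, Prod.snd_mul, mul_assoc]
  add_mem' := by
    intro z w hz hw g
    change (z.1 : Op L) (toState g) + (w.1 : Op L) (toState g) = _
    rw [hw, hz, Prod.snd_add, add_mul, map_add]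
  algebraMap_mem' := by
    intro c g
    change c • toState g = _
    rw [← map_smul, MvPolynomial.smul_eq_C_mul]
    rfl

/-- Operators and polynomials are paired in a subalgebra of the product ring, where determinants are
computed componentwise. -/
theorem det_mem_symbolRel {ι : Type*} [Fintype ι] [DecidableEq ι] {M : Matrix ι ι Γ.WedgeAlgebra}
    {M' : Matrix ι ι (MvPolynomial (Osc L) ℂ)} (h : ∀ a b, (M a b, M' a b) ∈ Γ.symbolRel) :
    (M.det, M'.det) ∈ Γ.symbolRel := by
  set K : Matrix ι ι (Γ.WedgeAlgebra × MvPolynomial (Osc L) ℂ) :=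
    Matrix.of fun a b => (M a b, M' a b)
  have h1 : K.det.1 = M.det := RingHom.map_det (RingHom.fst _ _) K
  have h2 : K.det.2 = M'.det := RingHom.map_det (RingHom.snd _ _) K
  have h3 : K.det ∈ Γ.symbolRel := by
    rw [Matrix.det_apply]
    refine sum_mem fun σ _ => ?_
    rw [Units.smul_def]
    exact zsmul_mem (prod_mem fun i _ => h _ _) _
  rwa [← h1, ← h2]

/-- The polynomial `det(1 - γ ε F†)`. -/
def detPoly (γ : Matrix (Osc L) (Osc L) ℂ) : MvPolynomial (Osc L) ℂ :=
  (1 - γ.map (algebraMap ℂ (MvPolynomial (Osc L) ℂ)) * Γ.bracketMatrix).det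

theorem detOp_mem_symbolRel (γ : Matrix (Osc L) (Osc L) ℂ) (x : Fin (2 * L) → ℝ) :
    (Γ.detOp γ x, scaleHom x (Γ.detPoly γ)) ∈ Γ.symbolRel := by
  rw [detPoly, AlgHom.map_det]
  refine Γ.det_mem_symbolRel fun p q => ?_
  have hw (r s : Osc L) : (Γ.epsWedge x r s, scaleHom x (Γ.bracketMatrix r s)) ∈ Γ.symbolRel := by
    intro g
    change eps r.2 s.2 • ((x r.1 * x s.1 : ℝ) : ℂ) • Γ.wedge r.1 s.1 (toState g) =
      toState (scaleHom x (eps r.2 s.2 • Γ.bracket r.1 s.1) * g)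
    rw [wedge_toState, map_smul, smul_mul_assoc, map_smul, ← map_smul toState _ (_ * g),
      ← smul_mul_assoc]
    congr 3
    rw [bracket]
    split_ifs
    · simp only [scaleHom, map_sub, map_mul, MvPolynomial.aeval_X, MvPolynomial.smul_eq_C_mul,
        Complex.ofReal_mul]
      ring
    · simp
  have : ((1 - γ.map (algebraMap ℂ Γ.WedgeAlgebra) * Γ.epsWedge x) p q,
      (scaleHom x).mapMatrix (1 - γ.map (algebraMap ℂ (MvPolynomial (Osc L) ℂ)) *
        Γ.bracketMatrix) p q) =
      (if p = q then 1 else 0) - ∑ r, algebraMap ℂ _ (γ p r) *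
        (Γ.epsWedge x r q, scaleHom x (Γ.bracketMatrix r q)) := by
    ext1
    · simp only [Matrix.sub_apply, Matrix.mul_apply, Matrix.one_apply, Matrix.map_apply,
        Prod.fst_sub, Prod.fst_sum, Prod.fst_mul, apply_ite Prod.fst]
      rfl
    · simp only [Matrix.sub_apply, Matrix.mul_apply, Matrix.one_apply, Matrix.map_apply,
        AlgHom.mapMatrix_apply, map_sub, map_mul, map_one, AlgHom.commutes,
        Prod.snd_sub, Prod.snd_sum, Prod.snd_mul, apply_ite Prod.snd]
      rfl
  rw [this]
  refine sub_mem ?_ (sum_mem fun r _ => mul_mem (Subalgebra.algebraMap_mem _ _) (hw r q))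
  split_ifs
  · exact one_mem _
  · exact zero_mem _

/-! ### The generating function as a Gaussian expectation -/

/-- The weights x_i x_j amount to rescaling the variables of seed i by x_i, so each coefficient is a
single monomial in `x` times its value at `x = 1`. -/
theorem generatingFunction_apply (γ : Matrix (Osc L) (Osc L) ℂ) (x : Fin (2 * L) → ℝ)
    (m : Occ L) : Γ.generatingFunction γ x (vacuum L) m =
      (∏ i, (x i : ℂ) ^ seedDegree (expo m) i) * ((Real.sqrt (mfact (expo m)) : ℂ) *
        ∑' k, (Nat.centralBinom k : ℂ) / 4 ^ k * ((1 - Γ.detPoly γ) ^ k).coeff (expo m)) := by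
  have h : ∀ g, (1 - (Γ.detOp γ x : Op L)) (toState g) =
      toState (scaleHom x (1 - Γ.detPoly γ) * g) := by
    intro g
    rw [LinearMap.sub_apply, Module.End.one_apply, Γ.detOp_mem_symbolRel γ x g, map_sub, map_one,
      sub_mul, map_sub, one_mul]
  rw [generatingFunction, formalSeries, ← tsum_mul_left, ← tsum_mul_left]
  refine tsum_congr fun k => ?_
  rw [pow_toState h, toState_apply, ← map_pow, coeff_scaleHom]
  ring

/-- Supplies the parameter t of the Gaussian identity. The brackets are quadratic, so grading by
degree replaces γεF† by t²γεF†; `expand 2` accounts for the square. -/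
theorem gradeHom_detPoly (γ : Matrix (Osc L) (Osc L) ℂ) :
    ∃ p : Polynomial (MvPolynomial (Osc L) ℂ),
      gradeHom (Γ.detPoly γ) = Polynomial.expand _ 2 p ∧
        (p : PowerSeries (MvPolynomial (Osc L) ℂ)) = (oneSubMul γ Γ.bracketMatrix).det := by
  set M := γ.map (algebraMap ℂ (MvPolynomial (Osc L) ℂ)) * Γ.bracketMatrix with hM
  refine ⟨(1 - (Polynomial.X : Polynomial (MvPolynomial (Osc L) ℂ)) •
    M.map Polynomial.C).det, ?_, ?_⟩
  · rw [detPoly, AlgHom.map_det, AlgHom.map_det]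
    congr 1
    have hb (p q : Osc L) : gradeHom (Γ.bracketMatrix p q) =
        Polynomial.C (Γ.bracketMatrix p q) * Polynomial.X ^ 2 := by
      rw [bracketMatrix, Matrix.of_apply, map_smul, bracket]
      split_ifs
      · simp only [gradeHom, map_sub, map_mul, MvPolynomial.aeval_X, Algebra.smul_def,
          MvPolynomial.algebraMap_eq]
        rw [IsScalarTower.algebraMap_apply ℂ (MvPolynomial (Osc L) ℂ)]
        simp only [Polynomial.algebraMap_eq, MvPolynomial.algebraMap_eq]
        ring
      · simp
    ext1 p q
    simp only [AlgHom.mapMatrix_apply, Matrix.map_apply, Matrix.sub_apply, map_sub,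
      Matrix.smul_apply, smul_eq_mul, map_mul, Polynomial.expand_X, Polynomial.expand_C]
    congr 1
    · simp only [Matrix.one_apply, apply_ite gradeHom, apply_ite (Polynomial.expand _ 2), map_one,
        map_zero]
    · simp only [hM, Matrix.mul_apply, map_sum, map_mul, hb, Matrix.map_apply, AlgHom.commutes,
        Finset.mul_sum]
      refine Finset.sum_congr rfl fun r _ => ?_
      rw [IsScalarTower.algebraMap_apply ℂ (MvPolynomial (Osc L) ℂ)]
      simp only [Polynomial.algebraMap_eq]
      ring
  · rw [← Polynomial.coeToPowerSeries.ringHom_apply, RingHom.map_det]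
    congr 1
    ext1 p q
    simp only [RingHom.mapMatrix_apply, Matrix.map_apply, Matrix.sub_apply, map_sub,
      Matrix.smul_apply, smul_eq_mul, map_mul, oneSubMul, ← hM,
      Polynomial.coeToPowerSeries.ringHom_apply, Polynomial.coe_X, Polynomial.coe_C]
    congr 1
    simp only [Matrix.one_apply]
    split_ifs <;> simp

/-- The coefficients of the polynomial form of `G(γ, 1)`. -/
def genCoeff (γ : Matrix (Osc L) (Osc L) ℂ) (m : Osc L →₀ ℕ) : ℂ :=
  if Even m.degree then
    (gaussianCoeff (expMoment γ) Γ.bracketMatrix (m.degree / 2)).coeff m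
  else 0

/-- In degree 2n the sum is the coefficient of t^n in the inverse square root of det(1 - tγB), which
uniqueness identifies with the Gaussian series. In odd degree every term vanishes. -/
theorem tsum_coeff_detPoly {γ : Matrix (Osc L) (Osc L) ℂ} (hγ : γ.transpose = γ)
    (m : Osc L →₀ ℕ) :
    ∑' k, (Nat.centralBinom k : ℂ) / 4 ^ k * ((1 - Γ.detPoly γ) ^ k).coeff m =
      Γ.genCoeff γ m := by
  obtain ⟨p, hp, hp'⟩ := Γ.gradeHom_detPoly γ
  have h0 (k : ℕ) : gradeHom ((1 - Γ.detPoly γ) ^ k) = Polynomial.expand _ 2 ((1 - p) ^ k) := by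
    rw [map_pow, map_sub, map_one, hp, map_pow, map_sub, map_one]
  rw [genCoeff]
  split_ifs with h
  · obtain ⟨n, hn⟩ := h
    have hn2 : m.degree = n * 2 := by omega
    have h1 (k : ℕ) : ((1 - Γ.detPoly γ) ^ k).coeff m =
        (PowerSeries.coeff n ((1 - (oneSubMul γ Γ.bracketMatrix).det) ^ k)).coeff m := by
      rw [← coeff_coeff_gradeHom, h0, hn2, Polynomial.coeff_expand_mul two_pos,
        ← Polynomial.coeff_coe, Polynomial.coe_pow, Polynomial.coe_sub, Polynomial.coe_one, hp']
    have hu : constantCoeff (1 - (oneSubMul γ Γ.bracketMatrix).det) = 0 := by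
      rw [map_sub, map_one, constantCoeff_det_oneSubMul, sub_self]
    have he := isWick_expMoment hγ
    have h2 : gaussianSeries (expMoment γ) Γ.bracketMatrix =
        invSqrtSeries.subst (1 - (oneSubMul γ Γ.bracketMatrix).det) := by
      refine powerSeries_invSqrt_unique (p := (oneSubMul γ Γ.bracketMatrix).det)
        (he.gaussianSeries_sq_mul_det Γ.bracketMatrix_transpose) ?_
        (he.constantCoeff_gaussianSeries _) (constantCoeff_invSqrtSeries_subst hu)
      have := invSqrtSeries_subst_sq_mul hu
      rwa [sub_sub_cancel] at this
    have h3 := congrArg (PowerSeries.coeff n) h2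
    rw [gaussianSeries, PowerSeries.coeff_mk, coeff_invSqrtSeries_subst hu] at h3
    rw [hn2, Nat.mul_div_cancel _ two_pos, h3, MvPolynomial.coeff_sum]
    simp only [h1]
    rw [tsum_eq_sum (s := Finset.range (n + 1))]
    · simp [MvPolynomial.coeff_smul]
    · intro k hk
      have : PowerSeries.coeff n ((1 - (oneSubMul γ Γ.bracketMatrix).det) ^ k) = 0 := by
        apply PowerSeries.coeff_of_lt_order
        refine lt_of_lt_of_le ?_ (PowerSeries.le_order_pow_of_constantCoeff_eq_zero k hu)
        simp at hk
        exact_mod_cast hk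
      rw [this]
      simp
  · have h1 (k : ℕ) : ((1 - Γ.detPoly γ) ^ k).coeff m = 0 := by
      rw [← coeff_coeff_gradeHom, h0, Polynomial.coeff_expand two_pos, if_neg]
      · simp
      · rwa [← even_iff_two_dvd]
    simp [h1]

end SeedGraph

namespace SeedGraph

variable {L N : ℕ} (Γ : SeedGraph L N)

/-! ### Link derivatives of monomials -/

/-- The family of monomials `c_m ∏ x_i^{n m i}`. -/
def monomialFamily (n : Occ L → Fin (2 * L) → ℕ) (c : FormalState L) (x : Fin (2 * L) → ℝ) :
    FormalState L := fun m => (∏ i, (x i : ℂ) ^ n m i) * c m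

/-- Truncation of the exponent at `n m i = 0` is harmless, since the coefficient vanishes there. -/
theorem partialDeriv_monomialFamily (i : Fin (2 * L)) (n : Occ L → Fin (2 * L) → ℕ)
    (c : FormalState L) : partialDeriv i (monomialFamily n c) =
      monomialFamily (fun m => n m - Pi.single i 1) fun m => n m i * c m := by
  ext x m
  have h1 (t : ℝ) : monomialFamily n c (Function.update x i t) m =
      (t : ℂ) ^ n m i * ((∏ j ∈ Finset.univ.erase i, (x j : ℂ) ^ n m j) * c m) := by
    rw [monomialFamily, ← Finset.mul_prod_erase _ _ (Finset.mem_univ i), Function.update_self,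
      mul_assoc]
    congr 2
    refine Finset.prod_congr rfl fun j hj => ?_
    rw [Function.update_of_ne (Finset.ne_of_mem_erase hj)]
  have h2 : HasDerivAt (fun t : ℝ => (t : ℂ) ^ n m i) (n m i * (x i : ℂ) ^ (n m i - 1)) (x i) := by
    simpa using (hasDerivAt_pow (n m i) (x i : ℂ)).comp_ofReal
  rw [partialDeriv]
  simp only [h1]
  rw [(h2.mul_const _).deriv, monomialFamily, ← Finset.mul_prod_erase _ _ (Finset.mem_univ i)]
  have h3 : ∏ j ∈ Finset.univ.erase i, (x j : ℂ) ^ (n m - Pi.single i 1 : Fin (2 * L) → ℕ) j =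
      ∏ j ∈ Finset.univ.erase i, (x j : ℂ) ^ n m j := by
    refine Finset.prod_congr rfl fun j hj => ?_
    simp [Finset.ne_of_mem_erase hj]
  rw [h3]
  simp only [Pi.sub_apply, Pi.single_eq_same]
  ring

theorem iterate_partialDeriv_monomialFamily {i j : Fin (2 * L)} (hij : i ≠ j) (k : ℕ)
    (n : Occ L → Fin (2 * L) → ℕ) (c : FormalState L) :
    (fun h => partialDeriv i (partialDeriv j h))^[k] (monomialFamily n c) =
      monomialFamily (fun m a => n m a - if i = a ∨ j = a then k else 0)
        fun m => (((n m i).descFactorial k * (n m j).descFactorial k : ℕ) : ℂ) * c m := by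
  induction k with
  | zero => simp
  | succ k ih =>
    rw [Function.iterate_succ_apply', ih, partialDeriv_monomialFamily, partialDeriv_monomialFamily]
    congr 1
    · ext m a
      by_cases h1 : i = a
      · subst h1
        simp [hij]
        omega
      · by_cases h2 : j = a
        · subst h2
          simp [h1, hij.symm]
          omega
        · simp [h1, h2, Ne.symm h1, Ne.symm h2]
    · ext m
      simp [hij, Nat.descFactorial_succ]
      ring

theorem source_ne_target (l l' : Fin L) : Γ.source l ≠ Γ.target l' := by
  intro h
  have h1 := (Γ.existsUnique_link (Γ.source l)).unique (Or.inl rfl) (Or.inr h.symm)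
  subst h1
  exact (Γ.source_lt_target l).ne h

theorem source_injective : Function.Injective Γ.source := fun l _ h =>
  (Γ.existsUnique_link (Γ.source l)).unique (Or.inl rfl) (Or.inl h.symm)

theorem target_injective : Function.Injective Γ.target := fun l _ h =>
  (Γ.existsUnique_link (Γ.target l)).unique (Or.inr rfl) (Or.inr h.symm)

theorem foldr_linkDeriv_monomialFamily (d : Fin L → ℕ) (n : Occ L → Fin (2 * L) → ℕ)
    (c : FormalState L) (s : List (Fin L)) (hs : s.Nodup) :
    s.foldr (fun l g => (fun h => partialDeriv (Γ.source l) (partialDeriv (Γ.target l) h))^[d l] g)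
        (monomialFamily n c) =
      monomialFamily
        (fun m a => n m a - (s.map fun l =>
          if Γ.source l = a ∨ Γ.target l = a then d l else 0).sum)
        fun m => (((s.map fun l => (n m (Γ.source l)).descFactorial (d l) *
          (n m (Γ.target l)).descFactorial (d l)).prod : ℕ) : ℂ) * c m := by
  induction s with
  | nil => simp
  | cons l s ih =>
    have hl := List.nodup_cons.1 hs
    rw [List.foldr_cons, ih hl.2, iterate_partialDeriv_monomialFamily (Γ.source_ne_target l l)]
    -- The two seeds of `l` lie on no other link, so the derivatives already taken leave their
    -- exponents unchanged.
    have h0 (i : Fin (2 * L)) (hi : Γ.source l = i ∨ Γ.target l = i) :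
        (s.map fun l => if Γ.source l = i ∨ Γ.target l = i then d l else 0).sum = 0 := by
      refine List.sum_eq_zero fun y hy => ?_
      obtain ⟨l', hl', rfl⟩ := List.mem_map.1 hy
      rw [if_neg]
      intro h
      exact hl.1 ((Γ.existsUnique_link i).unique hi h ▸ hl')
    congr 1
    · ext m a
      rw [List.map_cons, List.sum_cons]
      omega
    · ext m
      rw [h0 _ (Or.inl rfl), h0 _ (Or.inr rfl), List.map_cons, List.prod_cons, Nat.sub_zero,
        Nat.sub_zero]
      push_cast
      ring

/-- Twice the spin of a seed. -/
def seedOcc (d : Fin L → ℕ) (i : Fin (2 * L)) : ℕ :=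
  ∑ l with Γ.source l = i ∨ Γ.target l = i, d l

theorem seedSpin_eq (d : Fin L → ℕ) (i : Fin (2 * L)) :
    Γ.seedSpin d i = (Γ.seedOcc d i : ℝ) / 2 := by
  rw [seedSpin, seedOcc, Nat.cast_sum, Finset.sum_div]

theorem seedOcc_eq {d : Fin L → ℕ} {i : Fin (2 * L)} {l : Fin L}
    (h : Γ.source l = i ∨ Γ.target l = i) : Γ.seedOcc d i = d l := by
  rw [seedOcc, Finset.sum_eq_single l]
  · intro l' hl' hne
    exact (hne ((Γ.existsUnique_link i).unique (Finset.mem_filter.1 hl').2 h)).elim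
  · intro hl
    simp [h] at hl

theorem sum_seeds {M : Type*} [AddCommMonoid M] (f : Fin (2 * L) → M) :
    ∑ i, f i = ∑ l, (f (Γ.source l) + f (Γ.target l)) := by
  have h : Finset.univ = Finset.univ.image Γ.source ∪ Finset.univ.image Γ.target := by
    ext i
    obtain ⟨l, h | h, -⟩ := Γ.existsUnique_link i
    · simp [← h]
    · simp [← h]
  rw [h, Finset.sum_union, Finset.sum_image Γ.source_injective.injOn,
    Finset.sum_image Γ.target_injective.injOn, Finset.sum_add_distrib]
  rw [Finset.disjoint_left]
  intro i h1 h2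
  obtain ⟨l, -, rfl⟩ := Finset.mem_image.1 h1
  obtain ⟨l', -, h⟩ := Finset.mem_image.1 h2
  exact Γ.source_ne_target l l' h.symm

theorem sum_seedOcc (d : Fin L → ℕ) : ∑ i, Γ.seedOcc d i = 2 * ∑ l, d l := by
  rw [Γ.sum_seeds, Finset.mul_sum]
  refine Finset.sum_congr rfl fun l _ => ?_
  rw [Γ.seedOcc_eq (Or.inl rfl), Γ.seedOcc_eq (Or.inr rfl), two_mul]

/-- Only exponents equal to the orders of differentiation survive: a smaller one kills a falling
factorial, a larger one leaves a positive power of zero. -/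
theorem linkDeriv_monomialFamily_zero (d : Fin L → ℕ) (n : Occ L → Fin (2 * L) → ℕ)
    (c : FormalState L) (m : Occ L) :
    Γ.linkDeriv d (monomialFamily n c) 0 m =
      if n m = Γ.seedOcc d then (∏ l, ((d l).factorial : ℂ) ^ 2) * c m else 0 := by
  rw [linkDeriv, Γ.foldr_linkDeriv_monomialFamily d n c _ (List.nodup_finRange L), monomialFamily]
  have h1 (a : Fin (2 * L)) : ((List.finRange L).map fun l =>
      if Γ.source l = a ∨ Γ.target l = a then d l else 0).sum = Γ.seedOcc d a := by
    rw [← Fin.sum_univ_def, seedOcc, Finset.sum_filter]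
  simp only [h1, ← Fin.prod_univ_def]
  split_ifs with h
  · rw [h]
    simp only [Nat.sub_self, pow_zero, Finset.prod_const_one, one_mul,
      Γ.seedOcc_eq (Or.inl rfl), Γ.seedOcc_eq (Or.inr rfl), Nat.descFactorial_self]
    push_cast
    simp only [sq]
  · obtain ⟨i, hi⟩ := Function.ne_iff.1 h
    rcases lt_or_gt_of_ne hi with hi | hi
    · obtain ⟨l, hl, -⟩ := Γ.existsUnique_link i
      rw [Γ.seedOcc_eq hl] at hi
      rw [Finset.prod_eq_zero (s := Finset.univ) (i := l)
        (f := fun l => (n m (Γ.source l)).descFactorial (d l) *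
          (n m (Γ.target l)).descFactorial (d l)) (Finset.mem_univ l)]
      · simp
      · rcases hl with rfl | rfl
        · rw [Nat.descFactorial_of_lt hi, zero_mul]
        · rw [Nat.descFactorial_of_lt hi, mul_zero]
    · rw [Finset.prod_eq_zero (Finset.mem_univ i), zero_mul]
      rw [Pi.zero_apply, Complex.ofReal_zero, zero_pow (by omega)]

theorem linkDeriv_generatingFunction {γ : Matrix (Osc L) (Osc L) ℂ} (hγ : γ.transpose = γ)
    (d : Fin L → ℕ) (m : Occ L) :
    Γ.linkDeriv d (fun x => Γ.generatingFunction γ x (vacuum L)) 0 m =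
      if seedDegree (expo m) = Γ.seedOcc d then (∏ l, ((d l).factorial : ℂ) ^ 2) *
        ((Real.sqrt (mfact (expo m)) : ℂ) * Γ.genCoeff γ (expo m)) else 0 := by
  have h : (fun x => Γ.generatingFunction γ x (vacuum L)) =
      monomialFamily (fun m => seedDegree (expo m))
        fun m => (Real.sqrt (mfact (expo m)) : ℂ) * Γ.genCoeff γ (expo m) := by
    ext x m
    rw [generatingFunction_apply, Γ.tsum_coeff_detPoly hγ, monomialFamily]
  rw [h, linkDeriv_monomialFamily_zero]

end SeedGraph

theorem pderiv_pderiv_comm {σ : Type*} (i j : σ) (f : MvPolynomial σ ℂ) :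
    pderiv i (pderiv j f) = pderiv j (pderiv i f) := by
  classical
  have h : ⁅(pderiv i : Derivation ℂ (MvPolynomial σ ℂ) (MvPolynomial σ ℂ)),
      (pderiv j : Derivation ℂ (MvPolynomial σ ℂ) (MvPolynomial σ ℂ))⁆ = 0 := by
    refine MvPolynomial.derivation_ext fun k => ?_
    rw [Derivation.commutator_apply, MvPolynomial.pderiv_X, MvPolynomial.pderiv_X]
    simp only [Pi.single_apply]
    split_ifs <;> simp
  have := DFunLike.congr_fun h f
  rwa [Derivation.commutator_apply, Derivation.zero_apply, sub_eq_zero] at this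

/-! ### The Bargmann pairing -/

section

variable {ι : Type*} [Fintype ι]

/-- The bilinear form `∑ m! Φ_m f_m` on polynomials. -/
def pairing (Φ : MvPolynomial ι ℂ) : MvPolynomial ι ℂ →ₗ[ℂ] ℂ :=
  moment ℂ fun m => mfact m * Φ.coeff m

theorem pairing_monomial (Φ : MvPolynomial ι ℂ) (m : ι →₀ ℕ) (a : ℂ) :
    pairing Φ (MvPolynomial.monomial m a) = a * (mfact m * Φ.coeff m) := moment_monomial _ _

theorem pairing_eq_sum (Φ f : MvPolynomial ι ℂ) :
    pairing Φ f = ∑ m ∈ Φ.support, mfact m * Φ.coeff m * f.coeff m := by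
  classical
  rw [pairing, moment_eq_sum,
    Finset.sum_subset (Finset.subset_union_right (s₁ := Φ.support) (s₂ := f.support)),
    Finset.sum_subset (Finset.subset_union_left (s₁ := Φ.support) (s₂ := f.support))]
  · exact Finset.sum_congr rfl fun m _ => by
      rw [Algebra.algebraMap_self, RingHom.id_apply, mul_comm]
  · intro m _ hm
    rw [MvPolynomial.notMem_support_iff.1 hm, mul_zero, zero_mul]
  · intro m _ hm
    rw [MvPolynomial.notMem_support_iff.1 hm, zero_mul]

theorem pairing_sub (Φ Ψ f : MvPolynomial ι ℂ) :
    pairing (Φ - Ψ) f = pairing Φ f - pairing Ψ f := by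
  simp only [pairing, moment_eq_sum, MvPolynomial.coeff_sub, ← Finset.sum_sub_distrib]
  exact Finset.sum_congr rfl fun m _ => by simp only [map_mul, map_sub]; ring

/-- The weights `m!` make multiplication and differentiation adjoint. The form is bilinear, so
nothing is conjugated. -/
theorem pairing_X_mul (Φ f : MvPolynomial ι ℂ) (p : ι) :
    pairing Φ (MvPolynomial.X p * f) = pairing (pderiv p Φ) f := by
  induction f using MvPolynomial.induction_on' with
  | monomial m a =>
    rw [MvPolynomial.X, MvPolynomial.monomial_mul, pairing_monomial, pairing_monomial, add_comm,
      mfact_add_single, MvPolynomial.coeff_pderiv]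
    push_cast
    ring
  | add f g hf hg => rw [mul_add, map_add, map_add, hf, hg]

end

namespace SeedGraph

variable {L N : ℕ} (Γ : SeedGraph L N)

/-! ### The action of `gl(2)` at the nodes -/

/-- The generators `∑_{i ∈ n} X_{iA} ∂_{iB}` of the action of `gl(2)` at the node `n`. -/
def gl (n : Fin N) (A B : Fin 2) :
    Derivation ℂ (MvPolynomial (Osc L) ℂ) (MvPolynomial (Osc L) ℂ) :=
  ∑ i with Γ.node i = n, (MvPolynomial.X (i, A) : MvPolynomial (Osc L) ℂ) • pderiv (i, B)

theorem gl_apply (n : Fin N) (A B : Fin 2) (f : MvPolynomial (Osc L) ℂ) :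
    Γ.gl n A B f = ∑ i with Γ.node i = n, MvPolynomial.X (i, A) * pderiv (i, B) f := by
  have := congrFun (map_sum (Derivation.coeFnAddMonoidHom (R := ℂ) (A := MvPolynomial (Osc L) ℂ)
    (M := MvPolynomial (Osc L) ℂ)) (fun i => (MvPolynomial.X (i, A) : MvPolynomial (Osc L) ℂ) •
      pderiv (i, B)) {i | Γ.node i = n}) f
  rw [Finset.sum_apply] at this
  exact this

theorem gl_X (n : Fin N) (A B C : Fin 2) (j : Fin (2 * L)) :
    Γ.gl n A B (MvPolynomial.X (j, C)) =
      if Γ.node j = n ∧ B = C then MvPolynomial.X (j, A) else 0 := by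
  simp only [gl_apply, MvPolynomial.pderiv_X, Pi.single_apply, Prod.mk.injEq, mul_ite, mul_one,
    mul_zero]
  by_cases h : B = C
  · simp [h]
  · simp [h, Ne.symm h]

theorem pderiv_gl (n : Fin N) (A B C : Fin 2) (j : Fin (2 * L)) (f : MvPolynomial (Osc L) ℂ) :
    pderiv (j, C) (Γ.gl n A B f) = Γ.gl n A B (pderiv (j, C) f) +
      if Γ.node j = n ∧ C = A then pderiv (j, B) f else 0 := by
  simp only [gl_apply, map_sum, MvPolynomial.pderiv_mul, Finset.sum_add_distrib,
    MvPolynomial.pderiv_X, Pi.single_apply, Prod.mk.injEq, ite_mul, one_mul, zero_mul]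
  rw [add_comm]
  refine congrArg₂ (· + ·) ?_ ?_
  · exact Finset.sum_congr rfl fun i _ => by rw [pderiv_pderiv_comm]
  · by_cases h : C = A
    · simp [h]
    · simp [h, Ne.symm h]

/-- The wedge annihilation operator `F_{ij}`. -/
def unwedge (i j : Fin (2 * L)) (f : MvPolynomial (Osc L) ℂ) : MvPolynomial (Osc L) ℂ :=
  if Γ.node i = Γ.node j then
    pderiv (i, 0) (pderiv (j, 1) f) - pderiv (i, 1) (pderiv (j, 0) f)
  else 0

theorem pairing_bracket_mul (i j : Fin (2 * L)) (Φ f : MvPolynomial (Osc L) ℂ) :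
    pairing Φ (Γ.bracket i j * f) = pairing (Γ.unwedge i j Φ) f := by
  rw [bracket, unwedge]
  split_ifs
  · rw [sub_mul, map_sub, mul_assoc, mul_assoc, pairing_X_mul, pairing_X_mul, pairing_X_mul,
      pairing_X_mul, ← pairing_sub, pderiv_pderiv_comm (j, 1), pderiv_pderiv_comm (j, 0)]
  · rw [zero_mul, map_zero, pairing_eq_sum]
    simp

/-- Polynomials that are invariant under `SL(2)` and have degree `2 J_n` at each node `n`. -/
structure IsInvariant (J : Fin N → ℝ) (Φ : MvPolynomial (Osc L) ℂ) : Prop where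
  raise : ∀ n, Γ.gl n 0 1 Φ = 0
  lower : ∀ n, Γ.gl n 1 0 Φ = 0
  up : ∀ n, Γ.gl n 0 0 Φ = (J n : ℂ) • Φ
  down : ∀ n, Γ.gl n 1 1 Φ = (J n : ℂ) • Φ

/-- The wedge is a 2 × 2 determinant in the spinor indices: it commutes with the off-diagonal
generators and lowers both diagonal weights at its node by one. -/
theorem gl_unwedge {i j : Fin (2 * L)} (hij : Γ.node i = Γ.node j) (n : Fin N) (A B : Fin 2)
    (f : MvPolynomial (Osc L) ℂ) :
    Γ.gl n A B (Γ.unwedge i j f) = Γ.unwedge i j (Γ.gl n A B f) -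
      if Γ.node i = n ∧ A = B then Γ.unwedge i j f else 0 := by
  simp only [unwedge, if_pos hij, map_sub, pderiv_gl, map_add]
  by_cases h : Γ.node i = n
  · have h' : Γ.node j = n := hij ▸ h
    fin_cases A <;> fin_cases B <;> simp [h, h'] <;> ring
  · have h' : Γ.node j ≠ n := hij ▸ h
    simp [h, h']

theorem unwedge_smul (i j : Fin (2 * L)) (c : ℂ) (f : MvPolynomial (Osc L) ℂ) :
    Γ.unwedge i j (c • f) = c • Γ.unwedge i j f := by
  rw [unwedge, unwedge]
  split_ifs
  · simp only [Derivation.map_smul, smul_sub]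
  · simp

theorem unwedge_zero (i j : Fin (2 * L)) : Γ.unwedge i j 0 = 0 := by simp [unwedge]

variable {Γ} in
theorem IsInvariant.unwedge {J : Fin N → ℝ} {Φ : MvPolynomial (Osc L) ℂ}
    (h : Γ.IsInvariant J Φ) {i j : Fin (2 * L)} (hij : Γ.node i = Γ.node j) :
    Γ.IsInvariant (J - Pi.single (Γ.node i) 1) (Γ.unwedge i j Φ) where
  raise n := by rw [Γ.gl_unwedge hij, h.raise, unwedge_zero]; simp
  lower n := by rw [Γ.gl_unwedge hij, h.lower, unwedge_zero]; simp
  up n := by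
    rw [Γ.gl_unwedge hij, h.up, unwedge_smul]
    by_cases hn : Γ.node i = n
    · subst hn; simp [sub_smul]
    · simp [hn, Ne.symm hn]
  down n := by
    rw [Γ.gl_unwedge hij, h.down, unwedge_smul]
    by_cases hn : Γ.node i = n
    · subst hn; simp [sub_smul]
    · simp [hn, Ne.symm hn]

/-- The Capelli identity for the wedge operators. -/
theorem sum_bracket_mul_unwedge (n : Fin N) (f : MvPolynomial (Osc L) ℂ) :
    (1 / 2 : ℂ) • ∑ i with Γ.node i = n, ∑ j with Γ.node j = n,
      Γ.bracket i j * Γ.unwedge i j f =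
      Γ.gl n 0 0 (Γ.gl n 1 1 f) - Γ.gl n 0 1 (Γ.gl n 1 0 f) + Γ.gl n 0 0 f := by
  set T : Fin 2 → Fin 2 → Fin 2 → Fin 2 → MvPolynomial (Osc L) ℂ := fun A B C D =>
    ∑ i with Γ.node i = n, ∑ j with Γ.node j = n, MvPolynomial.X (i, A) *
      (MvPolynomial.X (j, B) * pderiv (i, C) (pderiv (j, D) f)) with hT
  have hswap (A B C D : Fin 2) : T A B C D = T B A D C := by
    simp only [hT]
    rw [Finset.sum_comm]
    refine Finset.sum_congr rfl fun i _ => Finset.sum_congr rfl fun j _ => ?_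
    rw [pderiv_pderiv_comm]
    ring
  -- Normal ordering; the commutator term produces the correction `gl n 0 0` of the Capelli
  -- determinant.
  have h1 (A B C D : Fin 2) : Γ.gl n A B (Γ.gl n C D f) =
      T A C B D + if B = C then Γ.gl n A D f else 0 := by
    conv_lhs => rw [gl_apply]
    simp only [pderiv_gl, mul_add, Finset.sum_add_distrib]
    congr 1
    · refine Finset.sum_congr rfl fun i _ => ?_
      rw [gl_apply, Finset.mul_sum]
      exact Finset.sum_congr rfl fun j _ => by rw [pderiv_pderiv_comm]
    · split_ifs with h
      · rw [gl_apply]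
        refine Finset.sum_congr rfl fun i hi => ?_
        rw [if_pos ⟨(Finset.mem_filter.1 hi).2, h⟩]
      · refine Finset.sum_eq_zero fun i _ => ?_
        rw [if_neg fun h' => h h'.2, mul_zero]
  have h2 : ∑ i with Γ.node i = n, ∑ j with Γ.node j = n, Γ.bracket i j * Γ.unwedge i j f =
      T 0 1 0 1 - T 0 1 1 0 - T 1 0 0 1 + T 1 0 1 0 := by
    simp only [hT, ← Finset.sum_sub_distrib, ← Finset.sum_add_distrib]
    refine Finset.sum_congr rfl fun i hi => Finset.sum_congr rfl fun j hj => ?_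
    have hij : Γ.node i = Γ.node j := by
      rw [(Finset.mem_filter.1 hi).2, (Finset.mem_filter.1 hj).2]
    rw [bracket, unwedge, if_pos hij, if_pos hij]
    ring
  rw [h2, h1, h1, hswap 1 0 0 1, hswap 1 0 1 0, MvPolynomial.smul_eq_C_mul]
  have h3 : (MvPolynomial.C (1 / 2 : ℂ) : MvPolynomial (Osc L) ℂ) * 2 = 1 := by
    rw [← map_ofNat (MvPolynomial.C (σ := Osc L) (R := ℂ)) 2, ← map_mul]
    norm_num
  rw [if_pos rfl, if_neg zero_ne_one]
  linear_combination (T 0 1 0 1 - T 0 1 1 0) * h3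

variable {Γ} in
theorem IsInvariant.sum_bracket_mul_unwedge {J : Fin N → ℝ} {Φ : MvPolynomial (Osc L) ℂ}
    (h : Γ.IsInvariant J Φ) (n : Fin N) :
    (1 / 2 : ℂ) • ∑ i with Γ.node i = n, ∑ j with Γ.node j = n,
      Γ.bracket i j * Γ.unwedge i j Φ = ((J n : ℂ) * (J n + 1)) • Φ := by
  rw [Γ.sum_bracket_mul_unwedge, h.down, h.lower, map_zero, Derivation.map_smul, h.up, smul_smul,
    sub_zero, ← add_smul, mul_add, mul_one]

theorem coeff_gl_self (n : Fin N) (A : Fin 2) (f : MvPolynomial (Osc L) ℂ) (m : Osc L →₀ ℕ) :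
    (Γ.gl n A A f).coeff m = ((∑ i with Γ.node i = n, m (i, A) : ℕ) : ℂ) * f.coeff m := by
  classical
  rw [gl_apply, MvPolynomial.coeff_sum, Nat.cast_sum, Finset.sum_mul]
  refine Finset.sum_congr rfl fun i _ => ?_
  rw [MvPolynomial.coeff_X_mul']
  by_cases h : m (i, A) = 0
  · simp [h]
  · rw [if_pos (by simpa using h), MvPolynomial.coeff_pderiv, sub_single_add_single h, mul_comm]
    congr 1
    have : m (i, A) - 1 + 1 = m (i, A) := by omega
    simp only [Finsupp.coe_tsub, Pi.sub_apply, Finsupp.single_eq_same]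
    exact_mod_cast this

variable {Γ} in
-- The diagonal generators count quanta, so a nonzero invariant has natural numbers as weights. A
-- non-integral `J n` forces Φ = 0.
theorem IsInvariant.eq_of_coeff_ne_zero {J : Fin N → ℝ} {Φ : MvPolynomial (Osc L) ℂ}
    (h : Γ.IsInvariant J Φ) {m : Osc L →₀ ℕ} (hm : Φ.coeff m ≠ 0) (n : Fin N) (A : Fin 2) :
    J n = (∑ i with Γ.node i = n, m (i, A) : ℕ) := by
  have h1 : Γ.gl n A A Φ = (J n : ℂ) • Φ := by
    fin_cases A
    · exact h.up n
    · exact h.down n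
  have h2 := congrArg (MvPolynomial.coeff m) h1
  rw [coeff_gl_self, MvPolynomial.coeff_smul, smul_eq_mul] at h2
  exact_mod_cast (mul_right_cancel₀ hm h2).symm

/-! ### The reproducing property of the generating function on invariants -/

/-- Contracting ε with the integration variables gives a second bracket: the kernel is ½ ∑ F_ij(z)
F_ij(w). -/
theorem quadForm_bracketMatrix : quadForm Γ.bracketMatrix =
    (1 / 2 : ℂ) • ∑ i, ∑ j, Γ.bracket i j •
      MvPolynomial.map (algebraMap ℂ (MvPolynomial (Osc L) ℂ)) (Γ.bracket i j) := by
  rw [quadForm, Fintype.sum_prod_type]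
  congr 1
  refine Finset.sum_congr rfl fun i _ => ?_
  simp only [Fin.sum_univ_two, Fintype.sum_prod_type, ← Finset.sum_add_distrib]
  refine Finset.sum_congr rfl fun j _ => ?_
  rw [MvPolynomial.smul_eq_C_mul]
  simp only [bracketMatrix, Matrix.of_apply, bracket, eps]
  split_ifs
  · simp
    ring
  · simp

/-- Peels off one factor of the kernel. Its bracket in the integration variables is stored in `h`,
which is why the inductions on `k` run over arbitrary `h`. -/
theorem moment_quadForm_pow_succ (e : (Osc L →₀ ℕ) → ℂ) (k : ℕ) (h : MvPolynomial (Osc L) ℂ) :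
    moment (MvPolynomial (Osc L) ℂ) e (quadForm Γ.bracketMatrix ^ (k + 1) *
      MvPolynomial.map (algebraMap ℂ (MvPolynomial (Osc L) ℂ)) h) =
    (1 / 2 : ℂ) • ∑ i, ∑ j, Γ.bracket i j *
      moment (MvPolynomial (Osc L) ℂ) e (quadForm Γ.bracketMatrix ^ k *
        MvPolynomial.map (algebraMap ℂ (MvPolynomial (Osc L) ℂ)) (Γ.bracket i j * h)) := by
  have : quadForm Γ.bracketMatrix ^ (k + 1) *
      MvPolynomial.map (algebraMap ℂ (MvPolynomial (Osc L) ℂ)) h =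
      (1 / 2 : ℂ) • ∑ i, ∑ j, Γ.bracket i j • (quadForm Γ.bracketMatrix ^ k *
        MvPolynomial.map (algebraMap ℂ (MvPolynomial (Osc L) ℂ)) (Γ.bracket i j * h)) := by
    rw [pow_succ', mul_assoc]
    nth_rw 1 [quadForm_bracketMatrix]
    rw [smul_mul_assoc, Finset.sum_mul]
    congr 1
    refine Finset.sum_congr rfl fun i _ => ?_
    rw [Finset.sum_mul]
    refine Finset.sum_congr rfl fun j _ => ?_
    rw [smul_mul_assoc, map_mul, mul_left_comm]
  rw [this, LinearMap.map_smul_of_tower]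
  simp only [map_sum, map_smul, smul_eq_mul]

theorem sum_sum_node {M : Type*} [AddCommMonoid M] (f : Fin (2 * L) → Fin (2 * L) → M)
    (hf : ∀ i j, Γ.node i ≠ Γ.node j → f i j = 0) :
    ∑ i, ∑ j, f i j = ∑ n, ∑ i with Γ.node i = n, ∑ j with Γ.node j = n, f i j := by
  rw [← Finset.sum_fiberwise Finset.univ Γ.node]
  refine Finset.sum_congr rfl fun n _ => Finset.sum_congr rfl fun i hi => ?_
  rw [Finset.sum_filter_of_ne]
  intro j _ hj
  by_contra h
  exact hj (hf i j fun h' => h (h' ▸ (Finset.mem_filter.1 hi).2))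

theorem prod_Gamma_sub_single {J : Fin N → ℝ} (n : Fin N) (hn : J n + 1 ≠ 0) :
    (∏ k, (Real.Gamma ((J - Pi.single n 1 : Fin N → ℝ) k + 2) : ℂ)) * (J n + 1) =
      ∏ k, (Real.Gamma (J k + 2) : ℂ) := by
  rw [← Finset.mul_prod_erase _ _ (Finset.mem_univ n),
    ← Finset.mul_prod_erase _ (fun k => (Real.Gamma (J k + 2) : ℂ)) (Finset.mem_univ n)]
  have h1 : Real.Gamma (J n + 2) = (J n + 1) * Real.Gamma (J n + 1) := by
    rw [← Real.Gamma_add_one hn]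
    congr 1
    ring
  have h2 : (J - Pi.single n 1 : Fin N → ℝ) n + 2 = J n + 1 := by
    simp
    ring
  have h3 : ∏ k ∈ Finset.univ.erase n, (Real.Gamma ((J - Pi.single n 1 : Fin N → ℝ) k + 2) : ℂ) =
      ∏ k ∈ Finset.univ.erase n, (Real.Gamma (J k + 2) : ℂ) := by
    refine Finset.prod_congr rfl fun k hk => ?_
    simp [Finset.ne_of_mem_erase hk]
  rw [h1, h2, h3]
  push_cast
  ring

variable {Γ} in
-- Peel off one kernel factor, move its bracket in `z` onto Φ as a wedge annihilation, and apply the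
-- induction hypothesis to the resulting invariant of lower weight. Capelli reassembles the sum at
-- node n to J_n(J_n+1)Φ. The factor J_n+1 restores Γ(J_n+2), and summing the J_n to k+1 restores
-- (k+1)!.
theorem IsInvariant.pairing_moment (e : (Osc L →₀ ℕ) → ℂ) {k : ℕ} {J : Fin N → ℝ}
    {Φ : MvPolynomial (Osc L) ℂ} (hΦ : Γ.IsInvariant J Φ) (hJ : ∑ n, J n = k)
    (h : MvPolynomial (Osc L) ℂ) :
    pairing Φ (moment (MvPolynomial (Osc L) ℂ) e (quadForm Γ.bracketMatrix ^ k *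
      MvPolynomial.map (algebraMap ℂ (MvPolynomial (Osc L) ℂ)) h)) =
    k.factorial * (∏ n, (Real.Gamma (J n + 2) : ℂ)) * moment ℂ e (Φ * h) := by
  by_cases h0 : Φ = 0
  · subst h0
    rw [pairing_eq_sum]
    simp
  obtain ⟨m, hm⟩ := MvPolynomial.ne_zero_iff.1 h0
  have hpos (n : Fin N) : 0 ≤ J n := by
    rw [hΦ.eq_of_coeff_ne_zero hm n 0]
    positivity
  induction k generalizing J Φ h m with
  | zero =>
    -- Nonnegative weights with sum zero vanish, so Φ is a constant.
    have hJ0 (n : Fin N) : J n = 0 :=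
      (Finset.sum_eq_zero_iff_of_nonneg fun n _ => hpos n).1 (by simpa using hJ) n
        (Finset.mem_univ n)
    have hm0 (m : Osc L →₀ ℕ) (hm : Φ.coeff m ≠ 0) : m = 0 := by
      ext ⟨i, A⟩
      have h1 := hΦ.eq_of_coeff_ne_zero hm (Γ.node i) A
      rw [hJ0] at h1
      have h2 := Finset.sum_eq_zero_iff.1 (by exact_mod_cast h1.symm : ∑ i' with
        Γ.node i' = Γ.node i, m (i', A) = 0) i (by simp)
      simpa using h2
    have hC : Φ = MvPolynomial.C (Φ.coeff 0) := by
      ext m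
      rw [MvPolynomial.coeff_C]
      split_ifs with hm1
      · rw [hm1]
      · by_contra hne
        exact hm1 (hm0 m hne).symm
    rw [hC, pow_zero, one_mul, moment_map, MvPolynomial.algebraMap_eq, ← MvPolynomial.smul_eq_C_mul,
      map_smul, ← MvPolynomial.monomial_zero', pairing_monomial]
    simp [hJ0, mfact]
    ring
  | succ k ih =>
    have ih' (i j : Fin (2 * L)) (hij : Γ.node i = Γ.node j) :
        pairing (Γ.unwedge i j Φ) (moment (MvPolynomial (Osc L) ℂ) e
          (quadForm Γ.bracketMatrix ^ k *
            MvPolynomial.map (algebraMap ℂ (MvPolynomial (Osc L) ℂ)) (Γ.bracket i j * h))) =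
        k.factorial * (∏ n, (Real.Gamma ((J - Pi.single (Γ.node i) 1 : Fin N → ℝ) n + 2) : ℂ)) *
          moment ℂ e (Γ.bracket i j * Γ.unwedge i j Φ * h) := by
      have hinv := hΦ.unwedge hij
      -- The lowered weights are known to be nonnegative only if the image is nonzero; otherwise
      -- both sides vanish.
      by_cases h1 : Γ.unwedge i j Φ = 0
      · rw [h1, pairing_eq_sum]
        simp
      · obtain ⟨m', hm'⟩ := MvPolynomial.ne_zero_iff.1 h1
        have hsum : ∑ n, (J - Pi.single (Γ.node i) 1 : Fin N → ℝ) n = k := by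
          simp only [Pi.sub_apply, Finset.sum_sub_distrib, hJ, Finset.sum_pi_single',
            Finset.mem_univ, if_true]
          push_cast
          simp
        have hnonneg (n : Fin N) : 0 ≤ (J - Pi.single (Γ.node i) 1 : Fin N → ℝ) n := by
          rw [hinv.eq_of_coeff_ne_zero hm' n 0]
          positivity
        rw [ih hinv hsum _ h1 m' hm' hnonneg, mul_left_comm (Γ.unwedge i j Φ),
          ← mul_assoc (Γ.bracket i j)]
    rw [moment_quadForm_pow_succ, map_smul, map_sum]
    simp only [map_sum, pairing_bracket_mul]
    rw [Γ.sum_sum_node]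
    · have h2 (n : Fin N) : ∑ i with Γ.node i = n, ∑ j with Γ.node j = n,
          pairing (Γ.unwedge i j Φ) (moment (MvPolynomial (Osc L) ℂ) e
            (quadForm Γ.bracketMatrix ^ k * MvPolynomial.map
              (algebraMap ℂ (MvPolynomial (Osc L) ℂ)) (Γ.bracket i j * h))) =
          k.factorial * (∏ k, (Real.Gamma ((J - Pi.single n 1 : Fin N → ℝ) k + 2) : ℂ)) *
            moment ℂ e ((∑ i with Γ.node i = n, ∑ j with Γ.node j = n,
              Γ.bracket i j * Γ.unwedge i j Φ) * h) := by
        simp only [Finset.sum_mul, map_sum, Finset.mul_sum]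
        refine Finset.sum_congr rfl fun i hi => Finset.sum_congr rfl fun j hj => ?_
        have hi' := (Finset.mem_filter.1 hi).2
        rw [ih' i j (hi'.trans (Finset.mem_filter.1 hj).2.symm), hi']
      have h3 (n : Fin N) : (1 / 2 : ℂ) * moment ℂ e ((∑ i with Γ.node i = n,
          ∑ j with Γ.node j = n, Γ.bracket i j * Γ.unwedge i j Φ) * h) =
          (J n * (J n + 1)) * moment ℂ e (Φ * h) := by
        rw [← smul_eq_mul (1 / 2 : ℂ), ← map_smul, ← smul_mul_assoc, hΦ.sum_bracket_mul_unwedge,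
          smul_mul_assoc, map_smul, smul_eq_mul]
      simp only [h2]
      rw [smul_eq_mul, Finset.mul_sum]
      have h4 (n : Fin N) : (1 / 2 : ℂ) * (k.factorial *
          (∏ k, (Real.Gamma ((J - Pi.single n 1 : Fin N → ℝ) k + 2) : ℂ)) *
            moment ℂ e ((∑ i with Γ.node i = n, ∑ j with Γ.node j = n,
              Γ.bracket i j * Γ.unwedge i j Φ) * h)) =
          J n * (k.factorial * (∏ n, (Real.Gamma (J n + 2) : ℂ)) * moment ℂ e (Φ * h)) := by
        have hn : J n + 1 ≠ 0 := by linarith [hpos n]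
        rw [mul_left_comm, h3, ← prod_Gamma_sub_single n hn]
        ring
      simp only [h4]
      rw [← Finset.sum_mul, ← Complex.ofReal_sum, hJ, Nat.factorial_succ]
      push_cast
      ring
    · intro i j hij
      rw [SeedGraph.unwedge, if_neg hij, pairing_eq_sum]
      simp

/-! ### The generating function is invariant -/

/-- The outer variables enter the moment only through brackets. -/
theorem derivation_moment_eq_zero
    (D : Derivation ℂ (MvPolynomial (Osc L) ℂ) (MvPolynomial (Osc L) ℂ))
    (hD : ∀ i j, D (Γ.bracket i j) = 0) (e : (Osc L →₀ ℕ) → ℂ) (k : ℕ)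
    (h : MvPolynomial (Osc L) ℂ) :
    D (moment (MvPolynomial (Osc L) ℂ) e (quadForm Γ.bracketMatrix ^ k *
      MvPolynomial.map (algebraMap ℂ (MvPolynomial (Osc L) ℂ)) h)) = 0 := by
  induction k generalizing h with
  | zero => rw [pow_zero, one_mul, moment_map, Derivation.map_algebraMap]
  | succ k ih =>
    rw [moment_quadForm_pow_succ, Derivation.map_smul, map_sum, Finset.sum_eq_zero, smul_zero]
    intro i _
    rw [map_sum]
    refine Finset.sum_eq_zero fun j _ => ?_
    rw [Derivation.leibniz, hD, ih, smul_zero, smul_zero, add_zero]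

theorem derivation_gaussianCoeff_eq_zero
    (D : Derivation ℂ (MvPolynomial (Osc L) ℂ) (MvPolynomial (Osc L) ℂ))
    (hD : ∀ i j, D (Γ.bracket i j) = 0) (e : (Osc L →₀ ℕ) → ℂ) (k : ℕ) :
    D (gaussianCoeff e Γ.bracketMatrix k) = 0 := by
  have := Γ.derivation_moment_eq_zero D hD e k 1
  rw [map_one, mul_one] at this
  rw [gaussianCoeff, Derivation.map_smul, this, smul_zero]

theorem gl_bracket (n : Fin N) (A B : Fin 2) (i j : Fin (2 * L)) :
    Γ.gl n A B (Γ.bracket i j) = if A = B ∧ Γ.node i = n then Γ.bracket i j else 0 := by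
  rw [bracket]
  split_ifs with hij h h
  · simp only [map_sub, Derivation.leibniz, gl_X]
    obtain ⟨rfl, hn⟩ := h
    have h' : Γ.node j = n := hij ▸ hn
    fin_cases A <;> simp [hn, h'] <;> ring
  · simp only [map_sub, Derivation.leibniz, gl_X]
    by_cases hn : Γ.node i = n
    · have h' : Γ.node j = n := hij ▸ hn
      fin_cases A <;> fin_cases B <;> simp [hn, h'] at h ⊢ <;> ring
    · have h' : Γ.node j ≠ n := hij ▸ hn
      simp [hn, h']
  · simp
  · simp

theorem gl_gaussianCoeff_of_ne (n : Fin N) {A B : Fin 2} (hAB : A ≠ B)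
    (e : (Osc L →₀ ℕ) → ℂ) (k : ℕ) : Γ.gl n A B (gaussianCoeff e Γ.bracketMatrix k) = 0 :=
  Γ.derivation_gaussianCoeff_eq_zero _ (fun i j => by simp [gl_bracket, hAB]) e k

theorem gl_gaussianCoeff_self (n : Fin N) (e : (Osc L →₀ ℕ) → ℂ) (k : ℕ) :
    Γ.gl n 0 0 (gaussianCoeff e Γ.bracketMatrix k) =
      Γ.gl n 1 1 (gaussianCoeff e Γ.bracketMatrix k) := by
  have := Γ.derivation_gaussianCoeff_eq_zero (Γ.gl n 0 0 - Γ.gl n 1 1)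
    (fun i j => by simp [gl_bracket]) e k
  rwa [Derivation.sub_apply, sub_eq_zero] at this

end SeedGraph

namespace SeedGraph

variable {L N : ℕ} (Γ : SeedGraph L N)

/-! ### The multihomogeneous part -/

/-- The part of a polynomial of given seed degrees. -/
def seedPart (D : Fin (2 * L) → ℕ) (f : MvPolynomial (Osc L) ℂ) : MvPolynomial (Osc L) ℂ :=
  ∑ m ∈ f.support with seedDegree m = D, MvPolynomial.monomial m (f.coeff m)

theorem coeff_seedPart (D : Fin (2 * L) → ℕ) (f : MvPolynomial (Osc L) ℂ) (m : Osc L →₀ ℕ) :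
    (seedPart D f).coeff m = if seedDegree m = D then f.coeff m else 0 := by
  classical
  simp only [seedPart, MvPolynomial.coeff_sum, MvPolynomial.coeff_monomial, Finset.sum_ite_eq',
    Finset.mem_filter, MvPolynomial.mem_support_iff]
  by_cases h : seedDegree m = D
  · by_cases h' : f.coeff m = 0
    · simp [h, h']
    · simp [h, h']
  · simp [h]

/-- Each term X_{iA} ∂_{iB} moves a quantum within one seed and so preserves seed degrees. -/
theorem gl_seedPart (n : Fin N) (A B : Fin 2) (D : Fin (2 * L) → ℕ)
    (f : MvPolynomial (Osc L) ℂ) : Γ.gl n A B (seedPart D f) = seedPart D (Γ.gl n A B f) := by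
  classical
  ext m
  have key (i : Fin (2 * L)) :
      (MvPolynomial.X (i, A) * pderiv (i, B) (seedPart D f)).coeff m =
        if seedDegree m = D then (MvPolynomial.X (i, A) * pderiv (i, B) f).coeff m else 0 := by
    rw [MvPolynomial.coeff_X_mul', MvPolynomial.coeff_X_mul']
    by_cases h : m (i, A) = 0
    · simp [h]
    · have hm : seedDegree (m - Finsupp.single (i, A) 1 + Finsupp.single (i, B) 1) =
          seedDegree m := by
        have h0 := congrArg seedDegree (sub_single_add_single h)
        rw [← h0]
        funext j
        by_cases hj : j = i
        · subst hj
          fin_cases A <;> fin_cases B <;> simp [seedDegree] <;> omega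
        · simp [seedDegree, hj]
      have hs : (i, A) ∈ m.support := by simpa using h
      rw [if_pos hs, if_pos hs, MvPolynomial.coeff_pderiv, MvPolynomial.coeff_pderiv, coeff_seedPart, hm, ite_mul, zero_mul]
  rw [coeff_seedPart, gl_apply, gl_apply, MvPolynomial.coeff_sum, MvPolynomial.coeff_sum]
  simp only [key]
  split_ifs <;> simp

/-! ### The constraints acting on polynomial states -/

theorem nodeConstraint_toState (n : Fin N) (a : Fin 3) (f : MvPolynomial (Osc L) ℂ) :
    Γ.nodeConstraint n a (toState f) =
      toState ((1 / 2 : ℂ) • ∑ A, ∑ B, pauli a A B • Γ.gl n A B f) := by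
  simp only [nodeConstraint, flux, LinearMap.sum_apply, LinearMap.smul_apply,
    Module.End.mul_apply, annihilate_toState, create_toState, map_smul, map_sum, gl_apply,
    Finset.smul_sum]
  rw [Finset.sum_comm]
  refine Finset.sum_congr rfl fun A _ => ?_
  rw [Finset.sum_comm]

theorem gl_eq_zero_of_nodeConstraint {f : MvPolynomial (Osc L) ℂ} {n : Fin N}
    (h : ∀ a, Γ.nodeConstraint n a (toState f) = 0) :
    Γ.gl n 0 1 f = 0 ∧ Γ.gl n 1 0 f = 0 ∧ Γ.gl n 0 0 f = Γ.gl n 1 1 f := by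
  have h' (a : Fin 3) : ∑ A, ∑ B, pauli a A B • Γ.gl n A B f = 0 := by
    have h1 := h a
    rw [nodeConstraint_toState, ← map_zero toState] at h1
    have h2 := toState_injective h1
    rw [smul_eq_zero] at h2
    exact h2.resolve_left (by norm_num)
  have h0 : Γ.gl n 0 1 f + Γ.gl n 1 0 f = 0 := by simpa [pauli, Fin.sum_univ_two] using h' 0
  have h1 : -(Complex.I • Γ.gl n 0 1 f) + Complex.I • Γ.gl n 1 0 f = 0 := by
    simpa [pauli, Fin.sum_univ_two] using h' 1
  have h2 : Γ.gl n 0 0 f - Γ.gl n 1 1 f = 0 := by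
    simpa [pauli, Fin.sum_univ_two, sub_eq_add_neg] using h' 2
  have h3 : Γ.gl n 1 0 f = Γ.gl n 0 1 f := by
    rw [neg_add_eq_zero] at h1
    exact (smul_right_injective _ Complex.I_ne_zero h1).symm
  have h4 : Γ.gl n 0 1 f = 0 := by
    rw [h3, ← two_smul ℂ, smul_eq_zero] at h0
    exact h0.resolve_left two_ne_zero
  exact ⟨h4, h3.trans h4, sub_eq_zero.1 h2⟩

theorem nodeConstraint_eq_zero_of_gl {f : MvPolynomial (Osc L) ℂ} {n : Fin N}
    (h01 : Γ.gl n 0 1 f = 0) (h10 : Γ.gl n 1 0 f = 0) (h : Γ.gl n 0 0 f = Γ.gl n 1 1 f)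
    (a : Fin 3) : Γ.nodeConstraint n a (toState f) = 0 := by
  rw [nodeConstraint_toState, Fin.sum_univ_two, Fin.sum_univ_two, Fin.sum_univ_two, h01, h10, h]
  fin_cases a <;> simp [pauli]

theorem spinOp_apply (i : Fin (2 * L)) (ψ : FormalState L) (m : Occ L) :
    spinOp i ψ m = ((seedDegree (expo m) i : ℕ) : ℂ) / 2 * ψ m := by
  have h (p : Osc L) : create p (annihilate p ψ) m = m p * ψ m := by
    change (Real.sqrt (m p) : ℂ) *
      ((Real.sqrt ((Function.update m p (m p - 1) p : ℕ) + 1) : ℂ) *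
        ψ (Function.update (Function.update m p (m p - 1)) p
          (Function.update m p (m p - 1) p + 1))) = _
    rw [Function.update_self, Function.update_idem]
    by_cases hp : m p = 0
    · simp [hp]
    · have h1 : m p - 1 + 1 = m p := by omega
      have h2 : ((m p - 1 : ℕ) : ℝ) + 1 = m p := by exact_mod_cast h1
      rw [h1, h2, Function.update_eq_self, ← mul_assoc, ← Complex.ofReal_mul,
        Real.mul_self_sqrt (Nat.cast_nonneg _), Complex.ofReal_natCast]
  have h1 : spinOp i ψ m = (1 / 2 : ℂ) * (create (i, 0) (annihilate (i, 0) ψ) m +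
      create (i, 1) (annihilate (i, 1) ψ) m) := by
    simp only [spinOp, Fin.sum_univ_two]
    rfl
  rw [h1, h, h, seedDegree]
  simp
  ring

/-! ### Membership in the physical subspace -/

/-- The spin operators are diagonal in the occupation basis, so their eigenvalue equations are
conditions on the support, and these imply the link constraints. -/
theorem mem_physicalSpin_iff (d : Fin L → ℕ) (ψ : FockSpace L) :
    ψ ∈ Γ.physicalSpin d ↔ (∀ m, ψ m ≠ 0 → seedDegree (expo m) = Γ.seedOcc d) ∧
      ∀ n a, Γ.nodeConstraint n a (coeffs L ψ) = 0 := by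
  have hspin (i : Fin (2 * L)) (c : ℕ) :
      (spinOp i - ((c : ℂ) / 2) • (1 : Op L)) (coeffs L ψ) = 0 ↔
        ∀ m, ψ m ≠ 0 → seedDegree (expo m) i = c := by
    rw [funext_iff]
    refine forall_congr' fun m => ?_
    change spinOp i (coeffs L ψ) m - (c : ℂ) / 2 * ψ m = 0 ↔ _
    rw [spinOp_apply]
    change ((seedDegree (expo m) i : ℕ) : ℂ) / 2 * ψ m - (c : ℂ) / 2 * ψ m = 0 ↔ _
    rw [← sub_mul, mul_eq_zero, ← sub_div, div_eq_zero_iff, sub_eq_zero, Nat.cast_inj]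
    simp only [OfNat.ofNat_ne_zero, or_false]
    tauto
  simp only [physicalSpin, physical, Submodule.mem_inf, Submodule.mem_iInf, LinearMap.mem_ker,
    LinearMap.comp_apply, hspin]
  constructor
  · rintro ⟨⟨-, h1⟩, h2⟩
    refine ⟨fun m hm => funext fun i => ?_, h1⟩
    obtain ⟨l, h | h, -⟩ := Γ.existsUnique_link i
    · rw [Γ.seedOcc_eq (Or.inl h), ← h]
      exact (h2 l).1 m hm
    · rw [Γ.seedOcc_eq (Or.inr h), ← h]
      exact (h2 l).2 m hm
  · rintro ⟨h1, h2⟩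
    have h3 (l : Fin L) : (∀ m, ψ m ≠ 0 → seedDegree (expo m) (Γ.source l) = d l) ∧
        ∀ m, ψ m ≠ 0 → seedDegree (expo m) (Γ.target l) = d l := by
      refine ⟨fun m hm => ?_, fun m hm => ?_⟩
      · rw [h1 m hm, Γ.seedOcc_eq (Or.inl rfl)]
      · rw [h1 m hm, Γ.seedOcc_eq (Or.inr rfl)]
    refine ⟨⟨fun l => ?_, h2⟩, h3⟩
    have hs := (hspin (Γ.source l) (d l)).2 (h3 l).1
    have ht := (hspin (Γ.target l) (d l)).2 (h3 l).2
    rw [linkConstraint, LinearMap.sub_apply]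
    rw [LinearMap.sub_apply, sub_eq_zero] at hs ht
    rw [hs, ht]
    exact sub_self _

theorem finite_seedDegree_eq (D : Fin (2 * L) → ℕ) :
    {m : Occ L | seedDegree (expo m) = D}.Finite := by
  refine (Set.finite_Iic (fun p : Osc L => D p.1)).subset fun m hm p => ?_
  obtain ⟨i, A⟩ := p
  have h : m (i, 0) + m (i, 1) = D i := congrFun hm i
  fin_cases A
  · change m (i, 0) ≤ D i
    omega
  · change m (i, 1) ≤ D i
    omega

/-- Fixed seed degrees leave finitely many occupation numbers, so such states are polynomial. -/
theorem exists_toState_eq {ψ : FormalState L} (D : Fin (2 * L) → ℕ)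
    (h : ∀ m, ψ m ≠ 0 → seedDegree (expo m) = D) :
    ∃ f : MvPolynomial (Osc L) ℂ, toState f = ψ := by
  classical
  refine ⟨∑ m ∈ (finite_seedDegree_eq D).toFinset,
    MvPolynomial.monomial (expo m) (ψ m / Real.sqrt (mfact (expo m))), ?_⟩
  ext m
  simp only [toState_apply, MvPolynomial.coeff_sum, MvPolynomial.coeff_monomial,
    EmbeddingLike.apply_eq_iff_eq, Finset.sum_ite_eq', Set.Finite.mem_toFinset, Set.mem_ofPred_eq]
  split_ifs with hm
  · rw [mul_div_cancel₀ _ (sqrt_mfact_ne_zero _)]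
  · rw [mul_zero]
    by_contra h'
    exact hm (h m (Ne.symm h'))

theorem memℓp_toState (f : MvPolynomial (Osc L) ℂ) : Memℓp (toState f) 2 := by
  refine memℓp_gen (summable_of_hasFiniteSupport (Set.Finite.subset
    (f.support.finite_toSet.preimage (f := expo (L := L))
      (Finsupp.equivFunOnFinite.symm.injective.injOn)) fun m hm => ?_))
  by_contra h
  have h0 : f.coeff (expo m) = 0 := by simpa using h
  apply hm
  simp [toState_apply, h0]

/-- At each node the diagonal generators agree by the constraint and sum to the degree 2J_n, so each
acts as J_n. Conjugation, needed to pass from the inner product to the bilinear pairing, commutes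
with the generators and fixes the real J_n. -/
theorem isInvariant_of_mem {d : Fin L → ℕ} {f : MvPolynomial (Osc L) ℂ}
    (hf : ∀ m, f.coeff m ≠ 0 → seedDegree m = Γ.seedOcc d)
    (h : ∀ n a, Γ.nodeConstraint n a (toState f) = 0) :
    Γ.IsInvariant (Γ.nodeSpin d) (MvPolynomial.map (starRingEnd ℂ) f) := by
  have hmap (n : Fin N) (A B : Fin 2) : Γ.gl n A B (MvPolynomial.map (starRingEnd ℂ) f) =
      MvPolynomial.map (starRingEnd ℂ) (Γ.gl n A B f) := by
    simp only [gl_apply, map_sum, map_mul, MvPolynomial.map_X, MvPolynomial.pderiv_map]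
  have hsum (n : Fin N) : Γ.gl n 0 0 f + Γ.gl n 1 1 f = (2 * (Γ.nodeSpin d n : ℂ)) • f := by
    ext m
    rw [MvPolynomial.coeff_add, coeff_gl_self, coeff_gl_self, MvPolynomial.coeff_smul, smul_eq_mul,
      ← add_mul]
    by_cases hm : f.coeff m = 0
    · simp [hm]
    · congr 1
      have h1 : (2 : ℂ) * (Γ.nodeSpin d n : ℂ) =
          ((∑ i with Γ.node i = n, Γ.seedOcc d i : ℕ) : ℂ) := by
        simp only [nodeSpin, seedSpin_eq, ← Finset.sum_div]
        push_cast
        ring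
      rw [h1, ← hf m hm, ← Nat.cast_add, ← Finset.sum_add_distrib]
      rfl
  have hd (n : Fin N) : Γ.gl n 0 0 f = (Γ.nodeSpin d n : ℂ) • f := by
    have h1 := hsum n
    rw [← (Γ.gl_eq_zero_of_nodeConstraint (h n)).2.2, ← two_smul ℂ, mul_smul] at h1
    exact smul_right_injective _ (two_ne_zero' ℂ) h1
  have hstar (n : Fin N) : MvPolynomial.map (starRingEnd ℂ) ((Γ.nodeSpin d n : ℂ) • f) =
      (Γ.nodeSpin d n : ℂ) • MvPolynomial.map (starRingEnd ℂ) f := by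
    rw [MvPolynomial.smul_eq_C_mul, map_mul, MvPolynomial.map_C, Complex.conj_ofReal,
      MvPolynomial.smul_eq_C_mul]
  constructor
  · intro n
    rw [hmap, (Γ.gl_eq_zero_of_nodeConstraint (h n)).1, map_zero]
  · intro n
    rw [hmap, (Γ.gl_eq_zero_of_nodeConstraint (h n)).2.1, map_zero]
  · intro n
    rw [hmap, hd, hstar]
  · intro n
    rw [hmap, ← (Γ.gl_eq_zero_of_nodeConstraint (h n)).2.2, hd, hstar]

/-! ### The projection of the squeezed vacuum -/

theorem inner_toState (f : MvPolynomial (Osc L) ℂ) (w ψ : FockSpace L)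
    (hw : coeffs L w = toState f) : inner ℂ w ψ =
      ∑ m ∈ (MvPolynomial.map (starRingEnd ℂ) f).support, (Real.sqrt (mfact m) : ℂ) *
        (MvPolynomial.map (starRingEnd ℂ) f).coeff m * ψ m := by
  have hw' (m : Osc L →₀ ℕ) : w m = (Real.sqrt (mfact m) : ℂ) * f.coeff m := by
    have := congrFun hw m
    rw [toState_apply] at this
    have h2 : expo (m : Occ L) = m := Finsupp.equivFunOnFinite_symm_coe m
    rwa [h2] at this
  rw [lp.inner_eq_tsum, ← Finsupp.equivFunOnFinite.tsum_eq, tsum_eq_sum]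
  · refine Finset.sum_congr rfl fun m _ => ?_
    change inner ℂ (w m) (ψ m) = _
    rw [hw', MvPolynomial.coeff_map, RCLike.inner_apply, map_mul]
    simp
    ring
  · intro m hm
    change inner ℂ (w m) (ψ m) = _
    rw [MvPolynomial.notMem_support_iff, MvPolynomial.coeff_map, map_eq_zero] at hm
    rw [hw', hm, mul_zero, inner_zero_left]

theorem degree_eq_sum_seedDegree (m : Osc L →₀ ℕ) : m.degree = ∑ i, seedDegree m i := by
  rw [Finsupp.degree_eq_sum, Fintype.sum_prod_type]
  simp [seedDegree]

theorem sum_nodeSpin (d : Fin L → ℕ) : ∑ n, Γ.nodeSpin d n = (∑ l, d l : ℕ) := by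
  simp only [nodeSpin]
  rw [Finset.sum_fiberwise]
  simp only [seedSpin_eq]
  rw [← Finset.sum_div, ← Nat.cast_sum, sum_seedOcc]
  push_cast
  ring

theorem prod_Gamma_nodeSpin_ne_zero (d : Fin L → ℕ) :
    (∏ n, (Real.Gamma (Γ.nodeSpin d n + 2) : ℂ)) ≠ 0 := by
  refine Finset.prod_ne_zero_iff.2 fun n _ => ?_
  have h : 0 ≤ Γ.nodeSpin d n := by
    refine Finset.sum_nonneg fun i _ => ?_
    rw [seedSpin_eq]
    positivity
  exact_mod_cast (Real.Gamma_pos_of_pos (by linarith)).ne'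

/-- The polynomial of the projected squeezed vacuum. -/
def projectedPoly (γ : Matrix (Osc L) (Osc L) ℂ) (d : Fin L → ℕ) : MvPolynomial (Osc L) ℂ :=
  (∏ n, (Real.Gamma (Γ.nodeSpin d n + 2) : ℂ))⁻¹ •
    seedPart (Γ.seedOcc d) (gaussianCoeff (expMoment γ) Γ.bracketMatrix (∑ l, d l))

theorem toState_projectedPoly {γ : Matrix (Osc L) (Osc L) ℂ} (hγ : γ.transpose = γ)
    (d : Fin L → ℕ) : toState (Γ.projectedPoly γ d) =
      ((∏ n, (Real.Gamma (Γ.nodeSpin d n + 2) : ℂ))⁻¹ *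
        ∏ l, (1 / ((d l).factorial : ℂ) ^ 2)) •
          Γ.linkDeriv d (fun x => Γ.generatingFunction γ x (vacuum L)) 0 := by
  ext m
  rw [Pi.smul_apply, Γ.linkDeriv_generatingFunction hγ, projectedPoly, map_smul, Pi.smul_apply,
    toState_apply, coeff_seedPart, smul_eq_mul, smul_eq_mul, mul_assoc]
  congr 1
  split_ifs with h
  · have h1 : (expo m).degree = 2 * ∑ l, d l := by
      rw [degree_eq_sum_seedDegree, h, sum_seedOcc]
    have h2 : (∏ l, (1 / ((d l).factorial : ℂ) ^ 2)) * ∏ l, ((d l).factorial : ℂ) ^ 2 = 1 := by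
      rw [← Finset.prod_mul_distrib]
      refine Finset.prod_eq_one fun l _ => ?_
      have := Nat.cast_ne_zero (R := ℂ).2 (d l).factorial_ne_zero
      field_simp
    rw [genCoeff, if_pos (by rw [h1]; exact even_two_mul _), h1,
      Nat.mul_div_cancel_left _ two_pos, ← mul_assoc, h2, one_mul]
  · simp

theorem nodeConstraint_projectedPoly (γ : Matrix (Osc L) (Osc L) ℂ) (d : Fin L → ℕ) (n : Fin N)
    (a : Fin 3) : Γ.nodeConstraint n a (toState (Γ.projectedPoly γ d)) = 0 := by
  have h (A B : Fin 2) : Γ.gl n A B (Γ.projectedPoly γ d) =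
      (∏ n, (Real.Gamma (Γ.nodeSpin d n + 2) : ℂ))⁻¹ • seedPart (Γ.seedOcc d)
        (Γ.gl n A B (gaussianCoeff (expMoment γ) Γ.bracketMatrix (∑ l, d l))) := by
    rw [projectedPoly, Derivation.map_smul, gl_seedPart]
  have h0 : seedPart (Γ.seedOcc d) (0 : MvPolynomial (Osc L) ℂ) = 0 := by simp [seedPart]
  refine Γ.nodeConstraint_eq_zero_of_gl ?_ ?_ ?_ a
  · rw [h, Γ.gl_gaussianCoeff_of_ne n zero_ne_one, h0, smul_zero]
  · rw [h, Γ.gl_gaussianCoeff_of_ne n one_ne_zero, h0, smul_zero]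
  · rw [h, h, gl_gaussianCoeff_self]

/-- The reproducing property with `h = 1`; its factorial and Gamma values cancel the normalizations,
and Φ does not see the seed degrees that were cut off. -/
theorem pairing_projectedPoly {γ : Matrix (Osc L) (Osc L) ℂ} {d : Fin L → ℕ}
    {Φ : MvPolynomial (Osc L) ℂ} (hΦ : Γ.IsInvariant (Γ.nodeSpin d) Φ)
    (hd : ∀ m, Φ.coeff m ≠ 0 → seedDegree m = Γ.seedOcc d) :
    pairing Φ (Γ.projectedPoly γ d) = moment ℂ (expMoment γ) Φ := by
  have h1 (f : MvPolynomial (Osc L) ℂ) : pairing Φ (seedPart (Γ.seedOcc d) f) = pairing Φ f := by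
    rw [pairing_eq_sum, pairing_eq_sum]
    refine Finset.sum_congr rfl fun m hm => ?_
    rw [coeff_seedPart, if_pos (hd m (MvPolynomial.mem_support_iff.1 hm))]
  have h2 := hΦ.pairing_moment (expMoment γ) (Γ.sum_nodeSpin d) 1
  rw [map_one, mul_one, mul_one] at h2
  have h3 := Nat.cast_ne_zero (R := ℂ).2 (∑ l, d l).factorial_ne_zero
  rw [projectedPoly, map_smul, h1, gaussianCoeff, map_smul, h2, smul_eq_mul, smul_eq_mul, mul_assoc,
    inv_mul_cancel_left₀ h3, inv_mul_cancel_left₀ (Γ.prod_Gamma_nodeSpin_ne_zero d)]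

theorem spinProjector_physicalProjector (d : Fin L → ℕ) (ψ : FockSpace L) :
    Γ.spinProjector d (Γ.physicalProjector ψ) = Γ.spinProjector d ψ := by
  have h : Γ.physicalSpin d ≤ Γ.physical := inf_le_left
  exact DFunLike.congr_fun (Submodule.starProjection_comp_starProjection_of_le h) ψ

/-- The projection is the member of the subspace whose difference from the vector is orthogonal to
it. A test vector is a polynomial state; its products with the squeezed vacuum and with the
candidate are the two sides of `pairing_projectedPoly`. -/
theorem spinProjector_squeezedVacuum {γ : Matrix (Osc L) (Osc L) ℂ} (d : Fin L → ℕ)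
    (h : Memℓp (squeezedVacuum γ) 2) : Γ.spinProjector d ⟨squeezedVacuum γ, h⟩ =
      (⟨toState (Γ.projectedPoly γ d), memℓp_toState _⟩ : FockSpace L) := by
  refine Submodule.eq_starProjection_of_mem_of_inner_eq_zero ?_ fun w hw => ?_
  · rw [mem_physicalSpin_iff]
    refine ⟨fun m hm => ?_, Γ.nodeConstraint_projectedPoly γ d⟩
    by_contra hne
    apply hm
    change toState _ m = 0
    rw [toState_apply, projectedPoly, MvPolynomial.coeff_smul, coeff_seedPart, if_neg hne,
      smul_zero, mul_zero]
  · rw [mem_physicalSpin_iff] at hw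
    obtain ⟨f, hf⟩ := exists_toState_eq _ hw.1
    have hfd (m : Osc L →₀ ℕ) (hm : f.coeff m ≠ 0) : seedDegree m = Γ.seedOcc d := by
      have h2 : expo (m : Occ L) = m := Finsupp.equivFunOnFinite_symm_coe m
      rw [← h2]
      refine hw.1 _ ?_
      rw [← hf, toState_apply, h2]
      exact mul_ne_zero (sqrt_mfact_ne_zero m) hm
    have hinv : Γ.IsInvariant (Γ.nodeSpin d) (MvPolynomial.map (starRingEnd ℂ) f) := by
      refine Γ.isInvariant_of_mem hfd fun n a => ?_
      rw [hf]
      exact hw.2 n a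
    have hpair := Γ.pairing_projectedPoly (γ := γ) hinv fun m hm => hfd m fun h0 => hm (by
      rw [MvPolynomial.coeff_map, h0, map_zero])
    rw [inner_eq_zero_symm, inner_sub_right, sub_eq_zero, inner_toState f w _ hf.symm,
      inner_toState f w _ hf.symm]
    rw [pairing_eq_sum, moment_eq_sum] at hpair
    have hsq (m : Osc L →₀ ℕ) : (mfact m : ℂ) =
        (Real.sqrt (mfact m) : ℂ) * (Real.sqrt (mfact m) : ℂ) := by
      rw [← Complex.ofReal_mul, Real.mul_self_sqrt (Nat.cast_nonneg _), Complex.ofReal_natCast]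
    refine Eq.trans (Finset.sum_congr rfl fun m _ => ?_)
      (hpair.symm.trans (Finset.sum_congr rfl fun m _ => ?_))
    · have h2 : expo (m : Occ L) = m := Finsupp.equivFunOnFinite_symm_coe m
      change _ * squeezedVacuum γ m = _
      rw [squeezedVacuum_apply, h2, expMoment, hsq, Algebra.algebraMap_self, RingHom.id_apply]
      ring
    · have h2 : expo (m : Occ L) = m := Finsupp.equivFunOnFinite_symm_coe m
      change _ = _ * toState (Γ.projectedPoly γ d) m
      rw [toState_apply, h2, hsq]
      ring

end SeedGraph

end LoopGravity

end

/-- Twice the spin of the link `ℓ` is `d ℓ`, and `(J_n + 1)!` is `Γ(J_n + 2)`. -/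
theorem mainTheorem8 {L N : ℕ} (Γ : LoopGravity.SeedGraph L N)
    (γ : Matrix (LoopGravity.Osc L) (LoopGravity.Osc L) ℂ)
    (hγ : γ ∈ LoopGravity.siegelDisk L) (d : Fin L → ℕ) :
    ∃ h : Memℓp (LoopGravity.squeezedVacuum γ) 2,
      LoopGravity.coeffs L
          (Γ.spinProjector d (Γ.physicalProjector ⟨LoopGravity.squeezedVacuum γ, h⟩)) =
        ((∏ n, (Real.Gamma (Γ.nodeSpin d n + 2) : ℂ))⁻¹ *
            ∏ l, (1 / ((d l).factorial : ℂ) ^ 2)) •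
          Γ.linkDeriv d
            (fun x => Γ.generatingFunction γ x (LoopGravity.vacuum L)) 0 := by
  refine ⟨LoopGravity.memℓp_squeezedVacuum hγ, ?_⟩
  rw [Γ.spinProjector_physicalProjector, Γ.spinProjector_squeezedVacuum,
    ← Γ.toState_projectedPoly hγ.1]
  rfl
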